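/- For a locally compact (Hausdorff) group $G$ and a closed subgroup $H$ such that $G/H$ carries a nonzero $G$-invariant regular Borel measure $\mu$, let $\lambda_{G/H}$ be the unitary representation of $G$ on $L^2(G/H,\mu)$ by left translation, $(\lambda_{G/H}(g)\xi)(x)=\xi(g^{-1}x)$. Put $L^2_0(G/H,\mu)=\{\xi\in L^2(G/H,\mu): \int_{G/H}\xi\,d\mu=0\}$ if $\mu$ is finite and $L^2_0(G/H,\mu)=L^2(G/H,\mu)$ if $\mu$ is infinite. One says that $\lambda_{G/H}$ has a spectral gap if its restriction to $L^2_0(G/H,\mu)$ does not almost have invariant vectors, where a unitary representation $(\pi,\mathcal H)$ of $G$ almost has invariant vectors if for every compact $Q\subset G$ and every $\varepsilon>0$ there is a unit vector $\xi\in\mathcal H$ with $\sup_{x\in Q}\|\pi(x)\xi-\xi\|<\varepsilon$. Let $G$ be a separable locally compact group and let $H_1\subset H_2$ be closed subgroups of $G$ such that $G/H_2$ carries a nonzero $G$-invariant regular Borel measure and $H_2/H_1$ carries a nonzero $H_2$-invariant regular Borel measure. Assume that the $H_2$-representation $\lambda_{H_2/H_1}$ on $L^2(H_2/H_1)$ and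 the $G$-representation $\lambda_{G/H_2}$ on $L^2(G/H_2)$ both have a spectral gap. Then $G/H_1$ carries a nonzero $G$-invariant regular Borel measure, and for every such measure the $G$-representation $\lambda_{G/H_1}$ on $L^2(G/H_1)$ has a spectral gap. -/

import Mathlib

open MeasureTheory TopologicalSpace
open scoped ENNReal

noncomputable section

/-- A unitary representation `π` of a topological group `G` on `E` almost has invariant vectors:
for every compact subset `Q` of `G` and every `ε > 0` there is a unit vector `ξ` which is moved by
less than `ε` by every element of `Q`. -/
def AlmostHasInvariantVectors {G E : Type*} [Group G] [TopologicalSpace G]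
    [NormedAddCommGroup E] [InnerProductSpace ℂ E] (π : G →* (E ≃ₗᵢ[ℂ] E)) : Prop :=
  ∀ Q : Set G, IsCompact Q → ∀ ε : ℝ, 0 < ε →
    ∃ ξ : E, ‖ξ‖ = 1 ∧ ∀ x ∈ Q, ‖π x ξ - ξ‖ < ε

/-- The restriction of a unitary representation to an invariant subspace. -/
def restrictRep {G E : Type*} [Group G] [NormedAddCommGroup E] [InnerProductSpace ℂ E]
    (π : G →* (E ≃ₗᵢ[ℂ] E)) (W : Submodule ℂ E) (hW : ∀ g, ∀ ξ ∈ W, π g ξ ∈ W) :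
    G →* (W ≃ₗᵢ[ℂ] W) where
  toFun g :=
    { toFun := fun ξ => ⟨π g ξ, hW g ξ ξ.2⟩
      invFun := fun ξ => ⟨π g⁻¹ ξ, hW g⁻¹ ξ ξ.2⟩
      map_add' := fun ξ η => by ext; simp
      map_smul' := fun c ξ => by ext; simp
      left_inv := fun ξ => by
        ext
        change (π g⁻¹ * π g) (ξ : E) = ξ
        rw [← map_mul]; simp
      right_inv := fun ξ => by
        ext
        change (π g * π g⁻¹) (ξ : E) = ξ
        rw [← map_mul]; simp
      norm_map' := fun ξ => by
        change ‖π g (ξ : E)‖ = ‖(ξ : E)‖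
        simp }
  map_one' := by ext ξ; change (π 1) (ξ : E) = ξ; simp
  map_mul' g h := by ext ξ; change (π (g * h)) (ξ : E) = π g (π h ξ); simp

section Koopman

variable {G X : Type*} [Group G] [MulAction G X] [MeasurableSpace X] [MeasurableConstSMul G X]
  (μ : Measure X) [SMulInvariantMeasure G X μ]

/-- Left translation of a square integrable function by `g`: `x ↦ f (g⁻¹ • x)`. -/
def leftTranslate (g : G) (f : Lp ℂ 2 μ) : Lp ℂ 2 μ :=
  Lp.compMeasurePreserving (fun x => g⁻¹ • x) (measurePreserving_smul g⁻¹ μ) f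

theorem leftTranslate_ae_eq (g : G) (f : Lp ℂ 2 μ) :
    leftTranslate μ g f =ᵐ[μ] fun x => f (g⁻¹ • x) :=
  Lp.coeFn_compMeasurePreserving f (measurePreserving_smul g⁻¹ μ)

theorem leftTranslate_one (f : Lp ℂ 2 μ) : leftTranslate μ (1 : G) f = f := by
  apply Lp.ext
  filter_upwards [leftTranslate_ae_eq μ (1 : G) f] with x hx
  simpa using hx

theorem leftTranslate_mul (g h : G) (f : Lp ℂ 2 μ) :
    leftTranslate μ (g * h) f = leftTranslate μ g (leftTranslate μ h f) := by
  apply Lp.ext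
  filter_upwards [leftTranslate_ae_eq μ (g * h) f,
    leftTranslate_ae_eq μ g (leftTranslate μ h f),
    (measurePreserving_smul g⁻¹ μ).quasiMeasurePreserving.ae (leftTranslate_ae_eq μ h f)]
    with x h1 h2 h3
  rw [h1, h2, h3, mul_inv_rev, mul_smul]

variable (G)

/-- The unitary representation of `G` by left translation on `L²(X, μ)`, for a `G`-space `X`
with `G`-invariant measure `μ`: `(λ(g) f)(x) = f (g⁻¹ • x)`. -/
def leftRegularRep : G →* (Lp ℂ 2 μ ≃ₗᵢ[ℂ] Lp ℂ 2 μ) where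
  toFun g :=
    { toFun := leftTranslate μ g
      invFun := leftTranslate μ g⁻¹
      map_add' := fun f f' =>
        (Lp.compMeasurePreserving _ (measurePreserving_smul g⁻¹ μ)).map_add f f'
      map_smul' := fun c f =>
        (Lp.compMeasurePreservingₗ ℂ _ (measurePreserving_smul g⁻¹ μ)).map_smul c f
      left_inv := fun f => by rw [← leftTranslate_mul, inv_mul_cancel, leftTranslate_one]
      right_inv := fun f => by rw [← leftTranslate_mul, mul_inv_cancel, leftTranslate_one]
      norm_map' := fun f => Lp.norm_compMeasurePreserving f (measurePreserving_smul g⁻¹ μ) }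
  map_one' := by ext1 f; exact leftTranslate_one μ f
  map_mul' g h := by ext1 f; exact leftTranslate_mul μ g h f

theorem leftRegularRep_ae_eq (g : G) (f : Lp ℂ 2 μ) :
    leftRegularRep G μ g f =ᵐ[μ] fun x => f (g⁻¹ • x) :=
  leftTranslate_ae_eq μ g f

end Koopman

/-- The subspace `L²₀(X, μ)` of `L²(X, μ)`: the functions with integral zero if `μ` is finite,
and the whole of `L²(X, μ)` if `μ` is infinite. -/
def L2zero {X : Type*} [MeasurableSpace X] (μ : Measure X) : Submodule ℂ (Lp ℂ 2 μ) where
  carrier := {f | μ Set.univ < ∞ → ∫ x, f x ∂μ = 0}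
  zero_mem' := fun _ => by
    rw [integral_congr_ae (Lp.coeFn_zero ℂ 2 μ)]; simp
  add_mem' := fun {f g} hf hg hμ => by
    have : IsFiniteMeasure μ := ⟨hμ⟩
    have hfi : Integrable f μ := (Lp.memLp f).integrable one_le_two
    have hgi : Integrable g μ := (Lp.memLp g).integrable one_le_two
    rw [integral_congr_ae (Lp.coeFn_add f g)]
    simp only [Pi.add_apply]
    rw [integral_add hfi hgi, hf hμ, hg hμ, add_zero]
  smul_mem' := fun c f hf hμ => by
    rw [integral_congr_ae (Lp.coeFn_smul c f)]
    simp only [Pi.smul_apply]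
    rw [integral_smul, hf hμ, smul_zero]

theorem leftRegularRep_mem_L2zero {G X : Type*} [Group G] [MulAction G X] [MeasurableSpace X]
    [MeasurableConstSMul G X] (μ : Measure X) [SMulInvariantMeasure G X μ] (g : G)
    (f : Lp ℂ 2 μ) (hf : f ∈ L2zero μ) : leftRegularRep G μ g f ∈ L2zero μ := by
  intro hμ
  rw [integral_congr_ae (leftRegularRep_ae_eq G μ g f)]
  rw [(measurePreserving_smul g⁻¹ μ).integral_comp (measurableEmbedding_const_smul g⁻¹)]
  exact hf hμ

/-- The restriction `λ⁰` of the left regular representation to `L²₀(X, μ)`. -/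
def leftRegularRepZero (G : Type*) {X : Type*} [Group G] [MulAction G X] [MeasurableSpace X]
    [MeasurableConstSMul G X] (μ : Measure X) [SMulInvariantMeasure G X μ] :
    G →* (L2zero μ ≃ₗᵢ[ℂ] L2zero μ) :=
  restrictRep (leftRegularRep G μ) (L2zero μ) (leftRegularRep_mem_L2zero μ)

/-- The representation of `G` on `L²(X, μ)` has a spectral gap: its restriction to `L²₀(X, μ)`
does not almost have invariant vectors. -/
def HasSpectralGap (G : Type*) {X : Type*} [Group G] [TopologicalSpace G] [MulAction G X]
    [MeasurableSpace X] [MeasurableConstSMul G X] (μ : Measure X)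
    [SMulInvariantMeasure G X μ] : Prop :=
  ¬ AlmostHasInvariantVectors (leftRegularRepZero G μ)

end

open Set Filter Topology
open scoped Pointwise NNReal

/-! ### Poincaré inequalities from spectral gaps. -/

section PoincareInequality

/-! The space `G ⧸ H₁` fibres over `G ⧸ H₂` with fibre `H₂ ⧸ H₁`, so `L²(G ⧸ H₁)` is induced from
the `H₂`-representation on `L²(H₂ ⧸ H₁)`: a function `ξ` in `C_c` becomes an equivariant map `V`
from `G` to `L²` of the fibre. Spectral gaps are used as Poincaré inequalities: the norm of a vector
is bounded by its displacement under a compact set. One such inequality for `C_c` functions on `G ⧸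
H₁` suffices, by density (`not_almostHasInvariantVectors_of_dense`).

If `G ⧸ H₂` has infinite measure, the scalar function `‖V‖` lies in `L²` of the base and moves no
more than `V`, so the gap of the base bounds it (`exists_inducedNormSq_le_of_infinite`). If the base
is finite, that gap only says that `‖V‖` is close to a constant `κ`. When the fibre representation
has no almost invariant vectors, `V` is small over a compact set of positive measure, because moving
along the fibre is left translation by a conjugate (`exists_sq_norm_le_integral`); hence `κ` is
small (`exists_inducedNormSq_le_of_finite`). If the fibre is finite too, this applies to the
fibrewise mean-zero part of `V`; the fibre means form a function on the base, controlled by the gap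
there up to the total integral, which vanishes on `L²₀`.

The invariant measure comes from the Riesz theorem applied to the iterated integral. Its uniqueness
up to a scalar is reduced to that of Haar measure on `G`
(`exists_integral_eq_mul_of_smulInvariant`). -/

theorem sq_norm_toLp {X : Type*} [MeasurableSpace X] {μ : Measure X} {f : X → ℂ}
    (hf : MemLp f 2 μ) : ‖hf.toLp f‖ ^ 2 = ∫ x, ‖f x‖ ^ 2 ∂μ := by
  have h := @inner_self_eq_norm_sq ℂ _ _ _ _ (hf.toLp f)
  rw [← h, L2.inner_def, ← integral_re (L2.integrable_inner _ _)]
  apply integral_congr_ae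
  filter_upwards [hf.coeFn_toLp] with x hx
  rw [hx]
  exact inner_self_eq_norm_sq _

/-- A representation which does not almost have invariant vectors satisfies a Poincaré type
inequality. -/
theorem exists_bound_of_not_almostHasInvariantVectors {G E : Type*} [Group G] [TopologicalSpace G]
    [NormedAddCommGroup E] [InnerProductSpace ℂ E] {π : G →* (E ≃ₗᵢ[ℂ] E)}
    (hπ : ¬ AlmostHasInvariantVectors π) :
    ∃ Q : Set G, IsCompact Q ∧ ∃ R : ℝ, 0 < R ∧ ∀ ξ : E, ∀ B : ℝ, 0 ≤ B →
      (∀ g ∈ Q, ‖π g ξ - ξ‖ ≤ B) → ‖ξ‖ ≤ R * B := by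
  unfold AlmostHasInvariantVectors at hπ
  push Not at hπ
  obtain ⟨Q, hQ, ε, hε, h⟩ := hπ
  refine ⟨Q, hQ, ε⁻¹, by positivity, fun ξ B hB hξ => ?_⟩
  rcases eq_or_ne ξ 0 with rfl | h0
  · simp only [norm_zero]; positivity
  have hn : 0 < ‖ξ‖ := norm_pos_iff.2 h0
  obtain ⟨g, hg, hge⟩ := h (((‖ξ‖⁻¹ : ℝ) : ℂ) • ξ) (by
    rw [norm_smul, Complex.norm_real, norm_inv, norm_norm, inv_mul_cancel₀ hn.ne'])
  rw [map_smul, ← smul_sub, norm_smul, Complex.norm_real, norm_inv, norm_norm] at hge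
  have h1 := hξ g hg
  rw [inv_mul_eq_div, le_div_iff₀ hε]
  rw [inv_mul_eq_div, le_div_iff₀ hn] at hge
  linarith

/-- The Poincaré inequality for functions, given by a spectral gap. -/
theorem HasSpectralGap.exists_bound {G X : Type*} [Group G] [TopologicalSpace G] [MulAction G X]
    [MeasurableSpace X] [MeasurableConstSMul G X] {μ : Measure X} [SMulInvariantMeasure G X μ]
    (h : HasSpectralGap G μ) :
    ∃ Q : Set G, IsCompact Q ∧ ∃ R : ℝ, 0 < R ∧ ∀ f : X → ℂ, MemLp f 2 μ →
      (μ univ < ∞ → ∫ x, f x ∂μ = 0) → ∀ B : ℝ, 0 ≤ B →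
      (∀ g ∈ Q, ∫ x, ‖f (g⁻¹ • x) - f x‖ ^ 2 ∂μ ≤ B) → ∫ x, ‖f x‖ ^ 2 ∂μ ≤ R * B := by
  obtain ⟨Q, hQ, R, hR, hb⟩ := exists_bound_of_not_almostHasInvariantVectors h
  refine ⟨Q, hQ, R ^ 2, by positivity, fun f hf h0 B hB hfB => ?_⟩
  have hmem : hf.toLp f ∈ L2zero μ := fun hμ => by
    rw [integral_congr_ae hf.coeFn_toLp]; exact h0 hμ
  have key := hb ⟨hf.toLp f, hmem⟩ (√B) (Real.sqrt_nonneg _) (fun g hg => ?_)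
  · have : ‖hf.toLp f‖ ≤ R * √B := key
    rw [← sq_norm_toLp hf]
    calc ‖hf.toLp f‖ ^ 2 ≤ (R * √B) ^ 2 := by gcongr
      _ = R ^ 2 * B := by rw [mul_pow, Real.sq_sqrt hB]
  · change ‖leftRegularRep G μ g (hf.toLp f) - hf.toLp f‖ ≤ √B
    apply Real.le_sqrt_of_sq_le
    have hfg : MemLp (fun x => f (g⁻¹ • x)) 2 μ :=
      hf.comp_measurePreserving (measurePreserving_smul g⁻¹ μ)
    have e : leftRegularRep G μ g (hf.toLp f) = hfg.toLp _ := by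
      apply Lp.ext
      filter_upwards [leftRegularRep_ae_eq G μ g (hf.toLp f), hfg.coeFn_toLp,
        (measurePreserving_smul g⁻¹ μ).quasiMeasurePreserving.ae hf.coeFn_toLp] with x h1 h2 h3
      rw [h1, h2, h3]
    rw [e, ← MemLp.toLp_sub, sq_norm_toLp]
    exact hfB g hg

end PoincareInequality

/-! ### Right-invariant functions as functions on the quotient. -/

section Quotient

variable {G : Type*} [Group G]

/-- The function on `G ⧸ H` induced by a right `H`-invariant function on `G`. -/
noncomputable def onQuotient {α : Type*} (H : Subgroup G) (F : G → α) : G ⧸ H → α :=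
  fun z => F z.out

theorem onQuotient_mk {α : Type*} {H : Subgroup G} {F : G → α}
    (hF : ∀ x, ∀ h : H, F (x * h) = F x) (x : G) : onQuotient H F (x : G ⧸ H) = F x := by
  obtain ⟨h, hh⟩ := QuotientGroup.mk_out_eq_mul H x
  rw [onQuotient, hh, hF]

theorem smul_onQuotient {α : Type*} {H : Subgroup G} {F : G → α}
    (hF : ∀ x, ∀ h : H, F (x * h) = F x) (g : G) (z : G ⧸ H) :
    onQuotient H F (g • z) = onQuotient H (fun x => F (g * x)) z := by
  obtain ⟨x, rfl⟩ := QuotientGroup.mk_surjective z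
  rw [onQuotient_mk (fun x h => by rw [← mul_assoc, hF]), ← onQuotient_mk hF]
  rfl

variable [TopologicalSpace G]

theorem continuous_onQuotient {α : Type*} [TopologicalSpace α] {H : Subgroup G} {F : G → α}
    (hF : ∀ x, ∀ h : H, F (x * h) = F x) (hc : Continuous F) : Continuous (onQuotient H F) := by
  rw [(QuotientGroup.isQuotientMap_mk H).continuous_iff]
  convert hc using 1
  ext x
  exact onQuotient_mk hF x

theorem hasCompactSupport_onQuotient {α : Type*} [Zero α] {H : Subgroup G} [T2Space (G ⧸ H)]
    {F : G → α} {K : Set (G ⧸ H)} (hK : IsCompact K) (h : ∀ x : G, (x : G ⧸ H) ∉ K → F x = 0) :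
    HasCompactSupport (onQuotient H F) :=
  HasCompactSupport.intro hK fun z hz => h _ (by simpa using hz)

end Quotient

/-! ### Induced vectors and their displacement. -/

/-- Continuous equivariant maps `V : G → E`, compactly supported modulo `H`: the continuous
compactly supported vectors of the representation induced from `σ`. -/
structure IsInducedVector {G E : Type*} [Group G] [TopologicalSpace G] [NormedAddCommGroup E]
    [InnerProductSpace ℂ E] {H : Subgroup G} (σ : H →* (E ≃ₗᵢ[ℂ] E)) (V : G → E) : Prop where
  continuous : Continuous V
  map_mul_inv : ∀ x, ∀ h : H, V (x * (h⁻¹ : H)) = σ h (V x)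
  exists_compact : ∃ K : Set (G ⧸ H), IsCompact K ∧ ∀ x : G, (x : G ⧸ H) ∉ K → V x = 0

/-- The squared norm of an induced vector. -/
noncomputable def inducedNormSq {G E : Type*} [Group G] [NormedAddCommGroup E] {H : Subgroup G}
    [MeasurableSpace (G ⧸ H)] (μ : Measure (G ⧸ H)) (V : G → E) : ℝ :=
  ∫ z, onQuotient H (fun x => ‖V x‖ ^ 2) z ∂μ

namespace IsInducedVector

variable {G E : Type*} [Group G] [TopologicalSpace G] [NormedAddCommGroup E]
  [InnerProductSpace ℂ E] {H : Subgroup G} {σ : H →* (E ≃ₗᵢ[ℂ] E)} {V W : G → E}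

theorem map_mul (hV : IsInducedVector σ V) (x : G) (h : H) : V (x * h) = σ h⁻¹ (V x) := by
  simpa using hV.map_mul_inv x h⁻¹

theorem norm_map_mul (hV : IsInducedVector σ V) (x : G) (h : H) : ‖V (x * h)‖ = ‖V x‖ := by
  rw [hV.map_mul, LinearIsometryEquiv.norm_map]

theorem norm_sq_map_mul (hV : IsInducedVector σ V) (x : G) (h : H) :
    ‖V (x * h)‖ ^ 2 = ‖V x‖ ^ 2 := by
  rw [hV.norm_map_mul]

theorem continuous_norm_sq [IsTopologicalGroup G] (hV : IsInducedVector σ V) :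
    Continuous (onQuotient H fun x => ‖V x‖ ^ 2) :=
  continuous_onQuotient hV.norm_sq_map_mul (hV.continuous.norm.pow 2)

theorem continuous_norm [IsTopologicalGroup G] (hV : IsInducedVector σ V) :
    Continuous (onQuotient H fun x => ‖V x‖) :=
  continuous_onQuotient hV.norm_map_mul hV.continuous.norm

theorem hasCompactSupport_norm_sq [T2Space (G ⧸ H)] (hV : IsInducedVector σ V) :
    HasCompactSupport (onQuotient H fun x => ‖V x‖ ^ 2) := by
  obtain ⟨K, hK, h⟩ := hV.exists_compact
  exact hasCompactSupport_onQuotient hK fun x hx => by simp [h x hx]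

theorem hasCompactSupport_norm [T2Space (G ⧸ H)] (hV : IsInducedVector σ V) :
    HasCompactSupport (onQuotient H fun x => ‖V x‖) := by
  obtain ⟨K, hK, h⟩ := hV.exists_compact
  exact hasCompactSupport_onQuotient hK fun x hx => by simp [h x hx]

theorem sub [IsTopologicalGroup G] (hV : IsInducedVector σ V) (hW : IsInducedVector σ W) :
    IsInducedVector σ fun x => V x - W x where
  continuous := hV.continuous.sub hW.continuous
  map_mul_inv x h := by rw [hV.map_mul_inv, hW.map_mul_inv, map_sub]
  exists_compact := by
    obtain ⟨K, hK, h⟩ := hV.exists_compact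
    obtain ⟨L, hL, h'⟩ := hW.exists_compact
    refine ⟨K ∪ L, hK.union hL, fun x hx => ?_⟩
    rw [mem_union, not_or] at hx
    rw [h x hx.1, h' x hx.2, sub_zero]

theorem translate [IsTopologicalGroup G] (hV : IsInducedVector σ V) (g : G) :
    IsInducedVector σ fun x => V (g⁻¹ * x) where
  continuous := hV.continuous.comp (continuous_const.mul continuous_id)
  map_mul_inv x h := by rw [← mul_assoc, hV.map_mul_inv]
  exists_compact := by
    obtain ⟨K, hK, h⟩ := hV.exists_compact
    refine ⟨g • K, hK.smul g, fun x hx => h _ fun hx' => hx ?_⟩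
    rw [mem_smul_set_iff_inv_smul_mem]
    exact hx'

variable [IsTopologicalGroup G] [MeasurableSpace (G ⧸ H)] [BorelSpace (G ⧸ H)]
  [T2Space (G ⧸ H)] {μ : Measure (G ⧸ H)}

theorem integrable_norm_sq [IsFiniteMeasureOnCompacts μ] (hV : IsInducedVector σ V) :
    Integrable (onQuotient H fun x => ‖V x‖ ^ 2) μ :=
  hV.continuous_norm_sq.integrable_of_hasCompactSupport hV.hasCompactSupport_norm_sq

theorem memLp_norm [IsFiniteMeasureOnCompacts μ] (hV : IsInducedVector σ V) :
    MemLp (fun z => ((onQuotient H (fun x => ‖V x‖) z : ℝ) : ℂ)) 2 μ :=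
  (Complex.continuous_ofReal.comp hV.continuous_norm).memLp_of_hasCompactSupport
    (hV.hasCompactSupport_norm.comp_left Complex.ofReal_zero)

/-- The reverse triangle inequality, integrated. It makes the gap of the base applicable to the
scalar function `‖V‖`. -/
theorem integral_sq_sub_le [IsFiniteMeasureOnCompacts μ] (hV : IsInducedVector σ V) (g : G) :
    ∫ z, ‖((onQuotient H (fun x => ‖V x‖) (g⁻¹ • z) : ℝ) : ℂ) -
      (onQuotient H (fun x => ‖V x‖) z : ℝ)‖ ^ 2 ∂μ ≤
      inducedNormSq μ fun x => V (g⁻¹ * x) - V x := by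
  have hd := (hV.translate g).sub hV
  refine integral_mono_of_nonneg (Eventually.of_forall fun z => by positivity)
    hd.integrable_norm_sq (Eventually.of_forall fun z => ?_)
  obtain ⟨x, rfl⟩ := QuotientGroup.mk_surjective z
  dsimp only
  rw [smul_onQuotient hV.norm_map_mul, onQuotient_mk (hV.translate g).norm_map_mul,
    onQuotient_mk hV.norm_map_mul, onQuotient_mk hd.norm_sq_map_mul, ← Complex.ofReal_sub,
    Complex.norm_real, Real.norm_eq_abs]
  have := abs_norm_sub_norm_le (V (g⁻¹ * x)) (V x)
  gcongr

omit [IsTopologicalGroup G] [BorelSpace (G ⧸ H)] [T2Space (G ⧸ H)] in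
theorem inducedNormSq_eq (hV : IsInducedVector σ V) :
    inducedNormSq μ V = ∫ z, ‖((onQuotient H (fun x => ‖V x‖) z : ℝ) : ℂ)‖ ^ 2 ∂μ := by
  apply integral_congr_ae (Eventually.of_forall fun z => ?_)
  obtain ⟨x, rfl⟩ := QuotientGroup.mk_surjective z
  rw [onQuotient_mk hV.norm_sq_map_mul, onQuotient_mk hV.norm_map_mul, Complex.norm_real,
    norm_norm]

end IsInducedVector

/-- If `G ⧸ H` has infinite measure and a spectral gap, no representation induced from `H` almost
has invariant vectors. -/
theorem exists_inducedNormSq_le_of_infinite {G E : Type*} [Group G] [TopologicalSpace G]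
    [IsTopologicalGroup G] [NormedAddCommGroup E] [InnerProductSpace ℂ E] {H : Subgroup G}
    [T2Space (G ⧸ H)] [MeasurableSpace (G ⧸ H)] [BorelSpace (G ⧸ H)]
    (μ : Measure (G ⧸ H)) [IsFiniteMeasureOnCompacts μ] [SMulInvariantMeasure G (G ⧸ H) μ]
    (hgap : HasSpectralGap G μ) (hμ : μ univ = ∞) (σ : H →* (E ≃ₗᵢ[ℂ] E)) :
    ∃ Q : Set G, IsCompact Q ∧ ∃ R : ℝ, 0 < R ∧ ∀ V : G → E, IsInducedVector σ V →
      ∀ B : ℝ, 0 ≤ B → (∀ g ∈ Q, inducedNormSq μ (fun x => V (g⁻¹ * x) - V x) ≤ B) →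
      inducedNormSq μ V ≤ R * B := by
  obtain ⟨Q, hQ, R, hR, h⟩ := hgap.exists_bound
  refine ⟨Q, hQ, R, hR, fun V hV B hB hVB => ?_⟩
  rw [hV.inducedNormSq_eq]
  -- In infinite measure `L²₀` is all of `L²`, so the nonnegative function `‖V‖` needs no centring.
  exact h _ hV.memLp_norm (fun h' => absurd hμ h'.ne) B hB
    fun g hg => (hV.integral_sq_sub_le g).trans (hVB g hg)

/-- If `σ` does not almost have invariant vectors, the value of an induced vector at a point of a
compact set is controlled by its variation. -/
theorem exists_sq_norm_le_integral {G E : Type*} [Group G] [TopologicalSpace G]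
    [IsTopologicalGroup G] [LocallyCompactSpace G] [T2Space G] [MeasurableSpace G] [BorelSpace G]
    [NormedAddCommGroup E] [InnerProductSpace ℂ E] {H : Subgroup G} {σ : H →* (E ≃ₗᵢ[ℂ] E)}
    (hσ : ¬ AlmostHasInvariantVectors σ) {C : Set G} (hC : IsCompact C) (m : Measure G)
    [m.IsHaarMeasure] :
    ∃ φ : G → ℝ, Continuous φ ∧ HasCompactSupport φ ∧ 0 ≤ φ ∧ ∃ R : ℝ, 0 < R ∧
      ∀ V : G → E, IsInducedVector σ V → ∀ x ∈ C,
        ‖V x‖ ^ 2 ≤ R * ∫ k, φ k * ‖V (k⁻¹ * x) - V x‖ ^ 2 ∂m := by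
  obtain ⟨Q, hQ, R, hR, hb⟩ := exists_bound_of_not_almostHasInvariantVectors hσ
  obtain ⟨ψ, hψc, hψ0, hψ1⟩ := exists_continuous_nonneg_pos (1 : G)
  have hpos : 0 < ∫ k, ψ k ∂m :=
    ψ.continuous.integral_pos_of_hasCompactSupport_nonneg_nonzero hψc hψ0 hψ1
  obtain ⟨b, hbd⟩ := ψ.continuous.bounded_above_of_compact_support hψc
  have hb0 : 0 ≤ b := (norm_nonneg _).trans (hbd 1)
  -- Contains every conjugate `x * h * x⁻¹` with `x ∈ C`, `h ∈ Q`; right translation of `x` by `h⁻¹`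
  -- is left translation by the inverse of that conjugate.
  let L : Set G := C * ((↑) '' Q) * C⁻¹
  have hL : IsCompact L := (hC.mul (hQ.image continuous_subtype_val)).mul hC.inv
  obtain ⟨χ, hχ1, -, hχc, hχ⟩ := exists_continuous_one_zero_of_isCompact
    (hψc.isCompact.union (hL.mul hψc.isCompact)) isClosed_empty (disjoint_empty _)
  -- A single weight dominating `ψ` and all its left translates by elements of `L`, so that `R` does
  -- not depend on `x` or `h`.
  let φ : G → ℝ := fun k => b * χ k
  have hφc : Continuous φ := continuous_const.mul χ.continuous
  have hφs : HasCompactSupport φ := hχc.mul_left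
  have hφ0 : 0 ≤ φ := fun k => mul_nonneg hb0 (hχ k).1
  have hψφ : ∀ k, ψ k ≤ φ k := fun k => by
    by_cases hk : k ∈ tsupport ψ
    · have : χ k = 1 := hχ1 (Or.inl hk)
      simpa [φ, this] using (le_abs_self _).trans (hbd k)
    · rw [image_eq_zero_of_notMem_tsupport hk]; exact hφ0 k
  have hψφ' : ∀ g ∈ L, ∀ k, ψ (g⁻¹ * k) ≤ φ k := fun g hg k => by
    by_cases hk : g⁻¹ * k ∈ tsupport ψ
    · have : χ k = 1 := hχ1 (Or.inr ⟨g, hg, _, hk, by simp⟩)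
      simpa [φ, this] using (le_abs_self _).trans (hbd (g⁻¹ * k))
    · rw [image_eq_zero_of_notMem_tsupport hk]; exact hφ0 k
  refine ⟨φ, hφc, hφs, hφ0, R ^ 2 * (4 / ∫ k, ψ k ∂m), by positivity, fun V hV x hx => ?_⟩
  let w : G → ℝ := fun k => ‖V (k⁻¹ * x) - V x‖ ^ 2
  have hw : Continuous w :=
    ((hV.continuous.comp (continuous_inv.mul continuous_const)).sub continuous_const).norm.pow 2
  have hw0 : ∀ k, 0 ≤ w k := fun k => by positivity
  have hint : ∀ f : G → ℝ, Continuous f → HasCompactSupport f → ∀ v : G → ℝ, Continuous v →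
      Integrable (fun k => f k * v k) m := fun f hf hfc v hv =>
    (hf.mul hv).integrable_of_hasCompactSupport hfc.mul_right
  have hI0 : 0 ≤ ∫ k, φ k * w k ∂m :=
    integral_nonneg fun k => mul_nonneg (hφ0 k) (hw0 k)
  have hvar : ∀ h ∈ Q, ‖σ h (V x) - V x‖ ^ 2 ≤ 4 / (∫ k, ψ k ∂m) * ∫ k, φ k * w k ∂m := by
    intro h hh
    let g : G := x * h * x⁻¹
    have hg : g ∈ L := ⟨x * h, ⟨x, hx, h, ⟨h, hh, rfl⟩, rfl⟩, x⁻¹, by simpa using hx, rfl⟩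
    -- Compare both vectors with `σ h (V (k⁻¹ * x))`, which equals `V ((g * k)⁻¹ * x)`. Averaging
    -- over `k` against `ψ` replaces pointwise displacement by an integral; each term costs at most
    -- `2 * ∫ φ w`, whence the 4.
    have h1 : ∀ k, ‖σ h (V x) - V x‖ ^ 2 ≤ 2 * w k + 2 * w (g * k) := fun k => by
      have e : V ((g * k)⁻¹ * x) = σ h (V (k⁻¹ * x)) := by
        rw [← hV.map_mul_inv]; congr 1; simp [g, mul_assoc]
      have h2 : ‖σ h (V x) - V x‖ ≤ ‖V (k⁻¹ * x) - V x‖ + ‖V ((g * k)⁻¹ * x) - V x‖ := by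
        rw [e, ← (σ h).norm_map (V (k⁻¹ * x) - V x), map_sub, norm_sub_rev (σ h (V (k⁻¹ * x)))]
        exact norm_sub_le_norm_sub_add_norm_sub _ _ _
      have h3 := norm_nonneg (σ h (V x) - V x)
      simp only [w]
      nlinarith [sq_nonneg (‖V (k⁻¹ * x) - V x‖ - ‖V ((g * k)⁻¹ * x) - V x‖)]
    have hwg : Continuous fun k => w (g * k) := hw.comp (continuous_const.mul continuous_id)
    have h4 : ∫ k, ψ k * w (g * k) ∂m ≤ ∫ k, φ k * w k ∂m := by
      have : ∫ k, ψ k * w (g * k) ∂m = ∫ k, ψ (g⁻¹ * k) * w k ∂m := by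
        simpa using integral_mul_left_eq_self (μ := m) (fun k => ψ (g⁻¹ * k) * w k) g
      rw [this]
      exact integral_mono_of_nonneg
        (Eventually.of_forall fun k => mul_nonneg (hψ0 _) (hw0 k)) (hint φ hφc hφs w hw)
        (Eventually.of_forall fun k => mul_le_mul_of_nonneg_right (hψφ' g hg k) (hw0 k))
    have h5 : ∫ k, ψ k * w k ∂m ≤ ∫ k, φ k * w k ∂m :=
      integral_mono_of_nonneg
        (Eventually.of_forall fun k => mul_nonneg (hψ0 _) (hw0 k)) (hint φ hφc hφs w hw)
        (Eventually.of_forall fun k => mul_le_mul_of_nonneg_right (hψφ k) (hw0 k))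
    have h6 : (∫ k, ψ k ∂m) * ‖σ h (V x) - V x‖ ^ 2 ≤
        2 * ∫ k, ψ k * w k ∂m + 2 * ∫ k, ψ k * w (g * k) ∂m := by
      have i1 := hint ψ ψ.continuous hψc w hw
      have i2 := hint ψ ψ.continuous hψc _ hwg
      rw [← integral_mul_const, ← integral_const_mul, ← integral_const_mul,
        ← integral_add (i1.const_mul 2) (i2.const_mul 2)]
      refine integral_mono (hint ψ ψ.continuous hψc _ continuous_const)
        ((i1.const_mul 2).add (i2.const_mul 2)) fun k => ?_
      have := mul_le_mul_of_nonneg_left (h1 k) (hψ0 k)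
      linarith
    rw [div_mul_eq_mul_div, le_div_iff₀ hpos]
    linarith
  have hfin := hb (V x) (√(4 / (∫ k, ψ k ∂m) * ∫ k, φ k * w k ∂m)) (Real.sqrt_nonneg _)
    fun h hh => Real.le_sqrt_of_sq_le (hvar h hh)
  calc ‖V x‖ ^ 2 ≤ (R * √(4 / (∫ k, ψ k ∂m) * ∫ k, φ k * w k ∂m)) ^ 2 := by gcongr
    _ = R ^ 2 * (4 / ∫ k, ψ k ∂m) * ∫ k, φ k * w k ∂m := by
      rw [mul_pow, Real.sq_sqrt (by positivity)]; ring

/-- If `G ⧸ H` has finite measure and a spectral gap and `σ` does not almost have invariant vectors,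
then the representation induced from `σ` does not almost have invariant vectors. -/
theorem exists_inducedNormSq_le_of_finite {G E : Type*} [Group G] [TopologicalSpace G]
    [IsTopologicalGroup G] [LocallyCompactSpace G] [T2Space G]
    [NormedAddCommGroup E] [InnerProductSpace ℂ E] {H : Subgroup G}
    [T2Space (G ⧸ H)] [MeasurableSpace (G ⧸ H)] [BorelSpace (G ⧸ H)]
    (μ : Measure (G ⧸ H)) [μ.Regular] [IsFiniteMeasure μ] [SMulInvariantMeasure G (G ⧸ H) μ]
    (hμ : μ ≠ 0) (hgap : HasSpectralGap G μ) {σ : H →* (E ≃ₗᵢ[ℂ] E)}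
    (hσ : ¬ AlmostHasInvariantVectors σ) :
    ∃ Q : Set G, IsCompact Q ∧ ∃ R : ℝ, 0 < R ∧ ∀ V : G → E, IsInducedVector σ V →
      ∀ B : ℝ, 0 ≤ B → (∀ g ∈ Q, inducedNormSq μ (fun x => V (g⁻¹ * x) - V x) ≤ B) →
      inducedNormSq μ V ≤ R * B := by
  let : MeasurableSpace G := borel G
  have : BorelSpace G := ⟨rfl⟩
  let m : Measure G := Measure.haar
  obtain ⟨C, hC, hC1⟩ := exists_compact_mem_nhds (1 : G)
  let C' : Set (G ⧸ H) := (↑) '' C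
  have hC' : IsCompact C' := hC.image QuotientGroup.continuous_mk
  have ha : 0 < μ.real C' := by
    have h1 : C' ∈ 𝓝 ((1 : G) : G ⧸ H) := QuotientGroup.isOpenMap_coe.image_mem_nhds hC1
    have h2 := measure_isOpen_pos_of_smulInvariant_of_ne_zero G hμ isOpen_interior
      ⟨_, mem_interior_iff_mem_nhds.2 h1⟩
    exact ENNReal.toReal_pos (h2.trans_le (measure_mono interior_subset)).ne'
      hC'.measure_lt_top.ne
  obtain ⟨φ, hφc, hφs, hφ0, R₁, hR₁, hφ⟩ := exists_sq_norm_le_integral hσ hC m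
  obtain ⟨Q, hQ, R₂, hR₂, hb⟩ := hgap.exists_bound
  have hΦ : 0 ≤ ∫ k, φ k ∂m := integral_nonneg hφ0
  have hM : 0 < μ.real univ := by
    rw [measureReal_def]
    exact ENNReal.toReal_pos (Measure.measure_univ_ne_zero.2 hμ) (measure_ne_top _ _)
  -- `Q` serves the gap of the base; `tsupport φ` is added to bound the displacements in the local
  -- estimate over `C`.
  refine ⟨Q ∪ tsupport φ, hQ.union hφs, 2 * R₂ + 2 * μ.real univ *
    ((2 * (R₁ * ∫ k, φ k ∂m) + 2 * R₂) / μ.real C'), by positivity, fun V hV B hB hVB => ?_⟩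
  let N : G ⧸ H → ℝ := onQuotient H fun x => ‖V x‖
  have hN : ∀ x : G, N x = ‖V x‖ := onQuotient_mk hV.norm_map_mul
  have hNc : Continuous N := hV.continuous_norm
  have hNs : HasCompactSupport N := hV.hasCompactSupport_norm
  have hNi : Integrable N μ := hNc.integrable_of_hasCompactSupport hNs
  -- The mean of `‖V‖`: the gap of the base bounds `N - κ`, leaving only `κ` to be estimated.
  let κ : ℝ := (∫ z, N z ∂μ) / μ.real univ
  have hA : inducedNormSq μ V = ∫ z, N z ^ 2 ∂μ := by
    rw [hV.inducedNormSq_eq]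
    simp [N]
  have hN2 : Integrable (fun z => N z ^ 2) μ :=
    Continuous.integrable_of_hasCompactSupport (by fun_prop)
      (hNs.comp_left (g := fun t => t ^ 2) (by simp))
  have hNκ : Integrable (fun z => (N z - κ) ^ 2) μ := by
    have : (fun z => (N z - κ) ^ 2) = fun z => N z ^ 2 - (2 * κ) * N z + κ ^ 2 := by
      ext z; ring
    rw [this]
    exact (hN2.sub (hNi.const_mul _)).add (integrable_const _)
  have hdev : ∫ z, (N z - κ) ^ 2 ∂μ ≤ R₂ * B := by
    have := hb (fun z => (N z : ℂ) - (κ : ℂ)) (hV.memLp_norm.sub (memLp_const _)) (fun _ => ?_) B hB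
      (fun g hg => ?_)
    · simpa [← Complex.ofReal_sub, Complex.norm_real] using this
    · simp_rw [← Complex.ofReal_sub]
      rw [integral_complex_ofReal, integral_sub hNi (integrable_const _), integral_const, smul_eq_mul,
        mul_div_cancel₀ _ hM.ne', sub_self, Complex.ofReal_zero]
    · simp_rw [sub_sub_sub_cancel_right]
      exact (hV.integral_sq_sub_le g).trans (hVB g (Or.inl hg))
  let F : G → G ⧸ H → ℝ := fun k => fun z =>
    φ k * onQuotient H (fun x => ‖V (k⁻¹ * x) - V x‖ ^ 2) z
  have hFmk : ∀ k (x : G), F k x = φ k * ‖V (k⁻¹ * x) - V x‖ ^ 2 := fun k x => by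
    simp only [F]
    rw [onQuotient_mk ((hV.translate k).sub hV).norm_sq_map_mul]
  -- Continuity is tested on `G × G`: the quotient map is open, so its product with the identity is
  -- again a quotient map.
  have hFc : Continuous F.uncurry := by
    rw [(IsOpenQuotientMap.id.prodMap
      (QuotientGroup.isOpenQuotientMap_mk (N := H))).isQuotientMap.continuous_iff]
    have : (F.uncurry ∘ Prod.map id ((↑) : G → G ⧸ H)) =
        fun p : G × G => φ p.1 * ‖V (p.1⁻¹ * p.2) - V p.2‖ ^ 2 := by
      ext p; exact hFmk p.1 p.2
    rw [this]
    have := hV.continuous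
    fun_prop
  obtain ⟨K, hK, hVK⟩ := hV.exists_compact
  have hL : IsCompact (K ∪ (fun p : G × (G ⧸ H) => p.1 • p.2) '' (tsupport φ ×ˢ K)) :=
    hK.union ((hφs.isCompact.prod hK).image continuous_smul)
  have hF0 : ∀ k z, z ∉ K ∪ (fun p : G × (G ⧸ H) => p.1 • p.2) '' (tsupport φ ×ˢ K) →
      F k z = 0 := fun k z hz => by
    obtain ⟨x, rfl⟩ := QuotientGroup.mk_surjective z
    rw [mem_union, not_or] at hz
    by_cases hk : k ∈ tsupport φ
    · have h1 := hVK x hz.1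
      have h2 : V (k⁻¹ * x) = 0 := hVK _ fun h => hz.2 ⟨(k, ((k⁻¹ * x : G) : G ⧸ H)), ⟨hk, h⟩, by
        change (((k * (k⁻¹ * x) : G)) : G ⧸ H) = x
        simp⟩
      rw [hFmk, h1, h2]; simp
    · simp [F, image_eq_zero_of_notMem_tsupport hk]
  -- Joint compact support lets the two integrals be exchanged without any σ-finiteness.
  have hFs : HasCompactSupport F.uncurry := by
    refine HasCompactSupport.intro (hφs.isCompact.prod hL) fun p hp => ?_
    rw [mem_prod, not_and_or] at hp
    rcases hp with hp | hp
    · simp [F, Function.uncurry, image_eq_zero_of_notMem_tsupport hp]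
    · exact hF0 _ _ hp
  have hDc : Continuous fun z => ∫ k, F k z ∂m := by
    rw [← continuousOn_univ]
    refine continuousOn_integral_of_compact_support (f := fun z k => F k z) hφs.isCompact
      (hFc.comp continuous_swap).continuousOn fun z k _ hk => ?_
    simp [F, image_eq_zero_of_notMem_tsupport hk]
  have hDi : Integrable (fun z => ∫ k, F k z ∂m) μ :=
    hDc.integrable_of_hasCompactSupport (HasCompactSupport.intro hL fun z hz => by
      simp [hF0 _ z hz])
  have hF_nonneg : ∀ k z, 0 ≤ F k z := fun k z => by
    obtain ⟨x, rfl⟩ := QuotientGroup.mk_surjective z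
    rw [hFmk]
    exact mul_nonneg (hφ0 k) (by positivity)
  have hD : ∫ z, ∫ k, F k z ∂m ∂μ ≤ (∫ k, φ k ∂m) * B := by
    rw [← integral_integral_swap_of_hasCompactSupport hFc hFs, ← integral_mul_const]
    refine integral_mono_of_nonneg
      (Eventually.of_forall fun k => integral_nonneg (hF_nonneg k))
      ((hφc.integrable_of_hasCompactSupport hφs).mul_const B)
      (Eventually.of_forall fun k => ?_)
    simp only [F]
    rw [integral_const_mul]
    by_cases hk : k ∈ tsupport φ
    · exact mul_le_mul_of_nonneg_left (hVB k (Or.inr hk)) (hφ0 k)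
    · simp [image_eq_zero_of_notMem_tsupport hk]
  have hCN : ∫ z in C', N z ^ 2 ∂μ ≤ R₁ * ((∫ k, φ k ∂m) * B) := by
    calc ∫ z in C', N z ^ 2 ∂μ ≤ ∫ z in C', R₁ * ∫ k, F k z ∂m ∂μ := by
          refine setIntegral_mono_on hN2.integrableOn (hDi.const_mul _).integrableOn
            hC'.measurableSet ?_
          rintro _ ⟨x, hx, rfl⟩
          simp only [hN, hFmk]
          exact hφ V hV x hx
      _ ≤ ∫ z, R₁ * ∫ k, F k z ∂m ∂μ :=
          setIntegral_le_integral (hDi.const_mul _) (Eventually.of_forall fun z =>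
            mul_nonneg hR₁.le (integral_nonneg fun k => hF_nonneg k z))
      _ ≤ _ := by
          rw [integral_const_mul]
          gcongr
  -- On `C'` the function `N` is small because of `σ`, and `N - κ` is small because of the base;
  -- hence so is the constant `κ`.
  have hκ : κ ^ 2 * μ.real C' ≤ (2 * (R₁ * ∫ k, φ k ∂m) + 2 * R₂) * B := by
    calc κ ^ 2 * μ.real C' = ∫ z in C', κ ^ 2 ∂μ := by
          rw [setIntegral_const, smul_eq_mul, mul_comm]
      _ ≤ ∫ z in C', (2 * N z ^ 2 + 2 * (N z - κ) ^ 2) ∂μ := by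
          refine integral_mono (integrable_const _)
            ((hN2.const_mul 2).add (hNκ.const_mul 2)).integrableOn fun z => ?_
          dsimp only
          nlinarith [sq_nonneg (2 * N z - κ)]
      _ = 2 * ∫ z in C', N z ^ 2 ∂μ + 2 * ∫ z in C', (N z - κ) ^ 2 ∂μ := by
          rw [integral_add (hN2.const_mul 2).integrableOn (hNκ.const_mul 2).integrableOn,
            integral_const_mul, integral_const_mul]
      _ ≤ _ := by
          have := setIntegral_le_integral (s := C') hNκ
            (Eventually.of_forall fun z => sq_nonneg (N z - κ))
          linarith
  calc inducedNormSq μ V = ∫ z, N z ^ 2 ∂μ := hA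
    _ ≤ ∫ z, (2 * (N z - κ) ^ 2 + 2 * κ ^ 2) ∂μ := by
        refine integral_mono hN2 ((hNκ.const_mul 2).add (integrable_const _)) fun z => ?_
        dsimp only
        nlinarith [sq_nonneg (N z - 2 * κ)]
    _ = 2 * ∫ z, (N z - κ) ^ 2 ∂μ + 2 * μ.real univ * κ ^ 2 := by
        rw [integral_add (hNκ.const_mul 2) (integrable_const _), integral_const_mul,
          integral_const, smul_eq_mul]
        ring
    _ ≤ 2 * (R₂ * B) + 2 * μ.real univ *
          ((2 * (R₁ * ∫ k, φ k ∂m) + 2 * R₂) * B / μ.real C') := by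
        rw [← le_div_iff₀ ha] at hκ
        gcongr
    _ = _ := by ring

/-! ### Fibrations over `G ⧸ H` and integration along the fibres. -/

/-- The `G`-space `X` fibres over `G ⧸ H` through `q`, the fibre over the base point being the
`H`-space `Y`, embedded by `i`. -/
structure IsFibration {G X Y : Type*} [Group G] [TopologicalSpace G] [TopologicalSpace X]
    [TopologicalSpace Y] (H : Subgroup G) [MulAction G X] [MulAction H Y] (i : Y → X)
    (q : X → G ⧸ H) : Prop where
  isClosedEmbedding : IsClosedEmbedding i
  map_smul : ∀ (h : H) (y : Y), i (h • y) = (h : G) • i y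
  continuous_proj : Continuous q
  proj_smul : ∀ (g : G) (x : X), q (g • x) = g • q x
  proj_apply : ∀ y, q (i y) = ((1 : G) : G ⧸ H)

/-- The function on `G ⧸ H` obtained by integrating a function on `X` along the fibres. -/
noncomputable def fiberIntegral {G X Y E : Type*} [Group G] (H : Subgroup G) [MulAction G X]
    [NormedAddCommGroup E] [NormedSpace ℝ E] (i : Y → X) [MeasurableSpace Y] (ν : Measure Y)
    (f : X → E) : G ⧸ H → E :=
  onQuotient H fun x => ∫ y, f (x • i y) ∂ν

theorem continuous_integral_of_locally_compact_support {G Y E : Type*} [TopologicalSpace G]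
    [WeaklyLocallyCompactSpace G] [TopologicalSpace Y] [MeasurableSpace Y]
    [OpensMeasurableSpace Y] {ν : Measure Y} [IsFiniteMeasureOnCompacts ν]
    [NormedAddCommGroup E] [NormedSpace ℝ E] {F : G → Y → E} (hF : Continuous F.uncurry)
    (hs : ∀ C : Set G, IsCompact C → ∃ K : Set Y, IsCompact K ∧ ∀ x ∈ C, ∀ y ∉ K, F x y = 0) :
    Continuous fun x => ∫ y, F x y ∂ν := by
  refine continuous_iff_continuousAt.2 fun x => ?_
  obtain ⟨C, hC, hx⟩ := exists_compact_mem_nhds x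
  obtain ⟨K, hK, h⟩ := hs C hC
  exact (continuousOn_integral_of_compact_support hK hF.continuousOn
    fun p y hp hy => h p hp y hy).continuousAt hx

namespace IsFibration

variable {G X Y E : Type*} [Group G] [TopologicalSpace G] [TopologicalSpace X]
  [TopologicalSpace Y] {H : Subgroup G} [MulAction G X] [MulAction H Y] {i : Y → X}
  {q : X → G ⧸ H}

theorem proj_smul_apply (hi : IsFibration H i q) (x : G) (y : Y) :
    q (x • i y) = (x : G ⧸ H) := by
  rw [hi.proj_smul, hi.proj_apply]
  change ((x * 1 : G) : G ⧸ H) = x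
  rw [mul_one]

theorem mul_smul_apply (hi : IsFibration H i q) (x : G) (h : H) (y : Y) :
    (x * h) • i y = x • i (h • y) := by
  rw [hi.map_smul, mul_smul]

theorem apply_eq_zero [Zero E] (hi : IsFibration H i q) {f : X → E} {x : G}
    (hx : (x : G ⧸ H) ∉ q '' tsupport f) (y : Y) : f (x • i y) = 0 := by
  by_contra h
  exact hx ⟨x • i y, subset_tsupport f h, hi.proj_smul_apply x y⟩

variable [ContinuousSMul G X]

theorem continuous_smul_apply (hi : IsFibration H i q) :
    Continuous fun p : G × Y => p.1 • i p.2 :=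
  continuous_fst.smul (hi.isClosedEmbedding.continuous.comp continuous_snd)

/-- If `f (x • i y) ≠ 0` with `x ∈ C`, then `i y` lies in the compact set `C⁻¹ • tsupport f`, whose
preimage under a closed embedding is compact. -/
theorem exists_isCompact_fiber [IsTopologicalGroup G] [Zero E] (hi : IsFibration H i q)
    {f : X → E} (hf : HasCompactSupport f) {C : Set G} (hC : IsCompact C) :
    ∃ K : Set Y, IsCompact K ∧ ∀ x ∈ C, ∀ y ∉ K, f (x • i y) = 0 := by
  refine ⟨i ⁻¹' ((fun p : G × X => p.1 • p.2) '' (C⁻¹ ×ˢ tsupport f)),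
    hi.isClosedEmbedding.isCompact_preimage ((hC.inv.prod hf).image continuous_smul),
    fun x hx y hy => ?_⟩
  by_contra h
  exact hy ⟨(x⁻¹, x • i y), ⟨by simpa using hx, subset_tsupport f h⟩, by simp⟩

theorem hasCompactSupport_fiber [IsTopologicalGroup G] [Zero E] [T2Space Y]
    (hi : IsFibration H i q) {f : X → E} (hf : HasCompactSupport f) (x : G) :
    HasCompactSupport fun y => f (x • i y) := by
  obtain ⟨K, hK, h⟩ := hi.exists_isCompact_fiber hf (isCompact_singleton (x := x))
  exact HasCompactSupport.intro hK fun y hy => h x rfl y hy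

theorem continuous_fiber [TopologicalSpace E] (hi : IsFibration H i q) {f : X → E}
    (hf : Continuous f) (x : G) : Continuous fun y => f (x • i y) :=
  hf.comp (hi.isClosedEmbedding.continuous.const_smul x)

variable [IsTopologicalGroup G] [NormedAddCommGroup E] [NormedSpace ℝ E]
  [MeasurableSpace Y] [BorelSpace Y] {ν : Measure Y}

omit [NormedSpace ℝ E] in
theorem integrable_fiber [IsFiniteMeasureOnCompacts ν] [T2Space Y]
    (hi : IsFibration H i q) {f : X → E} (hc : Continuous f) (hf : HasCompactSupport f) (x : G) :
    Integrable (fun y => f (x • i y)) ν :=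
  (hi.continuous_fiber hc x).integrable_of_hasCompactSupport (hi.hasCompactSupport_fiber hf x)

theorem continuous_integral_fiber [LocallyCompactSpace G] [IsFiniteMeasureOnCompacts ν]
    (hi : IsFibration H i q) {f : X → E} (hc : Continuous f) (hf : HasCompactSupport f) :
    Continuous fun x : G => ∫ y, f (x • i y) ∂ν :=
  continuous_integral_of_locally_compact_support (hc.comp hi.continuous_smul_apply)
    fun _ hC => hi.exists_isCompact_fiber hf hC

omit [ContinuousSMul G X] [IsTopologicalGroup G] in
theorem integral_fiber_mul [ContinuousConstSMul H Y] [SMulInvariantMeasure H Y ν]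
    (hi : IsFibration H i q) (f : X → E) (x : G) (h : H) :
    ∫ y, f ((x * h) • i y) ∂ν = ∫ y, f (x • i y) ∂ν := by
  simp_rw [hi.mul_smul_apply]
  exact (measurePreserving_smul h ν).integral_comp (measurableEmbedding_const_smul h)
    fun y => f (x • i y)

omit [ContinuousSMul G X] [IsTopologicalGroup G] in
theorem fiberIntegral_mk [ContinuousConstSMul H Y] [SMulInvariantMeasure H Y ν]
    (hi : IsFibration H i q) (f : X → E) (x : G) :
    fiberIntegral H i ν f (x : G ⧸ H) = ∫ y, f (x • i y) ∂ν :=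
  onQuotient_mk (hi.integral_fiber_mul f) x

omit [ContinuousSMul G X] [IsTopologicalGroup G] in
theorem fiberIntegral_smul [ContinuousConstSMul H Y] [SMulInvariantMeasure H Y ν]
    (hi : IsFibration H i q) (f : X → E) (g : G) (z : G ⧸ H) :
    fiberIntegral H i ν f (g • z) = fiberIntegral H i ν (fun x => f (g • x)) z := by
  obtain ⟨x, rfl⟩ := QuotientGroup.mk_surjective z
  change fiberIntegral H i ν f ((g * x : G) : G ⧸ H) = _
  rw [hi.fiberIntegral_mk, hi.fiberIntegral_mk]
  simp_rw [mul_smul]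

theorem continuous_fiberIntegral [LocallyCompactSpace G] [IsFiniteMeasureOnCompacts ν]
    [ContinuousConstSMul H Y] [SMulInvariantMeasure H Y ν]
    (hi : IsFibration H i q) {f : X → E} (hc : Continuous f) (hf : HasCompactSupport f) :
    Continuous (fiberIntegral H i ν f) :=
  continuous_onQuotient (hi.integral_fiber_mul f) (hi.continuous_integral_fiber hc hf)

omit [ContinuousSMul G X] [IsTopologicalGroup G] [BorelSpace Y] in
theorem hasCompactSupport_fiberIntegral [T2Space (G ⧸ H)] (hi : IsFibration H i q) {f : X → E}
    (hf : HasCompactSupport f) : HasCompactSupport (fiberIntegral H i ν f) :=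
  hasCompactSupport_onQuotient (hf.isCompact.image hi.continuous_proj) fun x hx => by
    simp [hi.apply_eq_zero hx]

theorem integrable_fiberIntegral [LocallyCompactSpace G] [IsFiniteMeasureOnCompacts ν]
    [ContinuousConstSMul H Y] [SMulInvariantMeasure H Y ν] [T2Space (G ⧸ H)]
    [MeasurableSpace (G ⧸ H)] [BorelSpace (G ⧸ H)] {μ : Measure (G ⧸ H)}
    [IsFiniteMeasureOnCompacts μ] (hi : IsFibration H i q) {f : X → E} (hc : Continuous f)
    (hf : HasCompactSupport f) : Integrable (fiberIntegral H i ν f) μ :=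
  (hi.continuous_fiberIntegral hc hf).integrable_of_hasCompactSupport
    (hi.hasCompactSupport_fiberIntegral hf)

/-- Invariant measures on the base and on the fibre give an invariant measure on the total
space. -/
theorem exists_measure [LocallyCompactSpace G] [T2Space X] [LocallyCompactSpace X]
    [MeasurableSpace X] [BorelSpace X] [T2Space Y] [IsFiniteMeasureOnCompacts ν]
    [ContinuousConstSMul H Y] [SMulInvariantMeasure H Y ν] [T2Space (G ⧸ H)]
    [MeasurableSpace (G ⧸ H)] [BorelSpace (G ⧸ H)] (μ : Measure (G ⧸ H))
    [IsFiniteMeasureOnCompacts μ] [SMulInvariantMeasure G (G ⧸ H) μ] (hi : IsFibration H i q) :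
    ∃ m : Measure X, m.Regular ∧ SMulInvariantMeasure G X m ∧
      ∀ f : X → ℝ, Continuous f → HasCompactSupport f →
        ∫ x, f x ∂m = ∫ z, fiberIntegral H i ν f z ∂μ := by
  -- The iterated integral is a positive functional; its Riesz measure is invariant because regular
  -- measures are determined by their integrals on `C_c`.
  let Λ : CompactlySupportedContinuousMap X ℝ →ₚ[ℝ] ℝ := PositiveLinearMap.mk₀
    { toFun f := ∫ z, fiberIntegral H i ν f z ∂μ
      map_add' f f' := by
        refine Eq.trans ?_ (integral_add
          (hi.integrable_fiberIntegral (ν := ν) f.continuous f.hasCompactSupport)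
          (hi.integrable_fiberIntegral (ν := ν) f'.continuous f'.hasCompactSupport))
        exact integral_congr_ae (Eventually.of_forall fun z =>
          integral_add (hi.integrable_fiber f.continuous f.hasCompactSupport _)
            (hi.integrable_fiber f'.continuous f'.hasCompactSupport _))
      map_smul' c f := by
        refine Eq.trans ?_ (integral_smul c _)
        exact integral_congr_ae (Eventually.of_forall fun z => integral_smul c _) }
    (fun f hf => integral_nonneg fun z => integral_nonneg fun y => hf _)
  have hΛ : ∀ f : X → ℝ, Continuous f → HasCompactSupport f →
      ∫ x, f x ∂(RealRMK.rieszMeasure Λ) = ∫ z, fiberIntegral H i ν f z ∂μ :=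
    fun f hc hf => RealRMK.integral_rieszMeasure Λ ⟨⟨f, hc⟩, hf⟩
  refine ⟨RealRMK.rieszMeasure Λ, inferInstance, ⟨fun g s hs => ?_⟩, hΛ⟩
  have hreg : ((RealRMK.rieszMeasure Λ).map (g • ·)).Regular :=
    Measure.Regular.map (Homeomorph.smul g)
  have e : (RealRMK.rieszMeasure Λ).map (g • ·) = RealRMK.rieszMeasure Λ := by
    refine Measure.ext_of_integral_eq_on_compactlySupported fun f => ?_
    rw [(measurableEmbedding_const_smul g).integral_map, hΛ f f.continuous f.hasCompactSupport,
      hΛ (fun x => f (g • x)) (f.continuous.comp (continuous_const_smul g))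
        (f.hasCompactSupport.comp_homeomorph (Homeomorph.smul g))]
    simp_rw [← hi.fiberIntegral_smul]
    exact (measurePreserving_smul g μ).integral_comp (measurableEmbedding_const_smul g) _
  rw [← Measure.map_apply (measurable_const_smul g) hs, e]

end IsFibration

/-! ### Lifting to `G` and uniqueness of invariant measures. -/

/-- A closed subgroup `H` is the fibre of `G` over `G ⧸ H`. -/
theorem isFibration_subgroup {G : Type*} [Group G] [TopologicalSpace G] {H : Subgroup G}
    (hH : IsClosed (H : Set G)) :
    IsFibration H ((↑) : H → G) ((↑) : G → G ⧸ H) where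
  isClosedEmbedding := hH.isClosedEmbedding_subtypeVal
  map_smul _ _ := rfl
  continuous_proj := QuotientGroup.continuous_mk
  proj_smul _ _ := rfl
  proj_apply h := by
    rw [QuotientGroup.eq]
    simp

/-- The quotient map is open, so images of compact neighbourhoods are neighbourhoods, and finitely
many cover `K`. -/
theorem exists_isCompact_image_mk {G : Type*} [Group G] [TopologicalSpace G]
    [IsTopologicalGroup G] [LocallyCompactSpace G] {H : Subgroup G} {K : Set (G ⧸ H)}
    (hK : IsCompact K) : ∃ C : Set G, IsCompact C ∧ K ⊆ (↑) '' C := by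
  refine hK.induction_on (p := fun K => ∃ C : Set G, IsCompact C ∧ K ⊆ (↑) '' C)
    ⟨∅, isCompact_empty, empty_subset _⟩ ?_ ?_ ?_
  · rintro s t hst ⟨C, hC, h⟩
    exact ⟨C, hC, hst.trans h⟩
  · rintro s t ⟨C, hC, h⟩ ⟨D, hD, h'⟩
    exact ⟨C ∪ D, hC.union hD, by rw [image_union]; exact union_subset_union h h'⟩
  · intro z _
    obtain ⟨x, rfl⟩ := QuotientGroup.mk_surjective z
    obtain ⟨C, hC, hx⟩ := exists_compact_mem_nhds x
    exact ⟨_, mem_nhdsWithin_of_mem_nhds (QuotientGroup.isOpenMap_coe.image_mem_nhds hx), C, hC,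
      subset_rfl⟩

/-- Every compactly supported continuous function on `G ⧸ H` is the fibre integral of a compactly
supported continuous function on `G`. -/
theorem exists_fiberIntegral_eq {G : Type*} [Group G] [TopologicalSpace G]
    [IsTopologicalGroup G] [LocallyCompactSpace G] [T2Space G] {H : Subgroup G}
    (hH : IsClosed (H : Set G)) [MeasurableSpace H] [BorelSpace H] (ν : Measure H)
    [ν.IsHaarMeasure] {f : G ⧸ H → ℝ} (hf : Continuous f) (hfc : HasCompactSupport f) :
    ∃ F : G → ℝ, Continuous F ∧ HasCompactSupport F ∧ fiberIntegral H ((↑) : H → G) ν F = f := by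
  have hi := isFibration_subgroup hH
  obtain ⟨C, hC, hfC⟩ := exists_isCompact_image_mk hfc.isCompact
  obtain ⟨ψ, hψ1, -, hψc, hψ⟩ := exists_continuous_one_zero_of_isCompact hC isClosed_empty
    (disjoint_empty C)
  let T : G ⧸ H → ℝ := fiberIntegral H ((↑) : H → G) ν ψ
  have hT : Continuous T := hi.continuous_fiberIntegral ψ.continuous hψc
  have hTpos : ∀ z ∈ tsupport f, 0 < T z := fun z hz => by
    obtain ⟨x, hx, rfl⟩ := hfC hz
    simp only [T]
    rw [hi.fiberIntegral_mk]
    refine (hi.continuous_fiber ψ.continuous x).integral_pos_of_hasCompactSupport_nonneg_nonzero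
      (hi.hasCompactSupport_fiber hψc x) (fun y => (hψ _).1) (x := 1) ?_
    have : ψ x = 1 := hψ1 hx
    simp [this]
  -- Off the support of `f` this is `0`, even where `T` vanishes. The lift is `ψ` times the pullback
  -- of `r`, whose fibre integral is `T * r = f`.
  let r : G ⧸ H → ℝ := fun z => f z / T z
  have hr : Continuous r := continuous_iff_continuousAt.2 fun z => by
    by_cases hz : z ∈ tsupport f
    · exact hf.continuousAt.div hT.continuousAt (hTpos z hz).ne'
    · have : r =ᶠ[𝓝 z] fun _ => 0 := by
        filter_upwards [(isClosed_tsupport f).isOpen_compl.mem_nhds hz] with w hw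
        simp [r, image_eq_zero_of_notMem_tsupport hw]
      exact continuousAt_const.congr this.symm
  refine ⟨fun x => ψ x * r (x : G ⧸ H), ψ.continuous.mul (hr.comp QuotientGroup.continuous_mk),
    hψc.mul_right, ?_⟩
  ext z
  obtain ⟨x, rfl⟩ := QuotientGroup.mk_surjective z
  rw [hi.fiberIntegral_mk]
  have h1 : ∀ h : H, ((x • (h : G) : G) : G ⧸ H) = x := fun h => hi.proj_smul_apply x h
  simp_rw [h1]
  rw [integral_mul_const, ← hi.fiberIntegral_mk]
  change T x * (f x / T x) = f x
  by_cases hx : (x : G ⧸ H) ∈ tsupport f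
  · rw [mul_div_cancel₀ _ (hTpos _ hx).ne']
  · simp [image_eq_zero_of_notMem_tsupport hx]

/-- Uniqueness of invariant measures on homogeneous spaces, up to a scalar. -/
theorem exists_integral_eq_mul_of_smulInvariant {G : Type*} [Group G] [TopologicalSpace G]
    [IsTopologicalGroup G] [LocallyCompactSpace G] [T2Space G] {H : Subgroup G}
    (hH : IsClosed (H : Set G)) [MeasurableSpace (G ⧸ H)] [BorelSpace (G ⧸ H)]
    (μ μ' : Measure (G ⧸ H)) [μ.Regular] [μ'.Regular]
    [SMulInvariantMeasure G (G ⧸ H) μ] [SMulInvariantMeasure G (G ⧸ H) μ']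
    (hμ : μ ≠ 0) (hμ' : μ' ≠ 0) :
    ∃ c : ℝ, 0 < c ∧ ∀ f : G ⧸ H → ℝ, Continuous f → HasCompactSupport f →
      ∫ z, f z ∂μ = c * ∫ z, f z ∂μ' := by
  have : IsClosed (H : Set G) := hH
  have : LocallyCompactSpace H := hH.isClosedEmbedding_subtypeVal.locallyCompactSpace
  let : MeasurableSpace G := borel G
  have : BorelSpace G := ⟨rfl⟩
  let : MeasurableSpace H := borel H
  have : BorelSpace H := ⟨rfl⟩
  -- Integrating `ρ` against Haar measure of `H` gives a left-invariant measure on `G`, hence a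
  -- multiple of Haar. If `c` were `0`, surjectivity of the fibre integral onto `C_c` would force `ρ
  -- = 0`.
  have key : ∀ ρ : Measure (G ⧸ H), ρ.Regular → SMulInvariantMeasure G (G ⧸ H) ρ → ρ ≠ 0 →
      ∃ c : ℝ, 0 < c ∧ ∀ F : G → ℝ, Continuous F → HasCompactSupport F →
        ∫ z, fiberIntegral H ((↑) : H → G) Measure.haar F z ∂ρ =
          c * ∫ x, F x ∂(Measure.haar : Measure G) := by
    intro ρ _ _ hρ
    obtain ⟨m, hm, hmi, hmf⟩ := (isFibration_subgroup hH).exists_measure (ν := Measure.haar) ρ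
    have : m.IsMulLeftInvariant := ⟨fun g => (measurePreserving_smul g m).map_eq⟩
    obtain ⟨c, hc⟩ := Measure.exists_integral_isMulLeftInvariant_eq_smul_of_hasCompactSupport m
      (Measure.haar : Measure G)
    have h : ∀ F : G → ℝ, Continuous F → HasCompactSupport F →
        ∫ z, fiberIntegral H ((↑) : H → G) Measure.haar F z ∂ρ =
          c * ∫ x, F x ∂(Measure.haar : Measure G) := fun F hF hFc => by
      rw [← hmf F hF hFc, hc F hF hFc, integral_smul_nnreal_measure]
      rfl
    refine ⟨c, lt_of_le_of_ne c.2 fun h0 => hρ ?_, h⟩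
    refine Measure.ext_of_integral_eq_on_compactlySupported fun f => ?_
    obtain ⟨F, hF, hFc, hFf⟩ := exists_fiberIntegral_eq hH Measure.haar f.continuous
      f.hasCompactSupport
    have hz := h F hF hFc
    rw [hFf, ← h0] at hz
    simpa using hz
  obtain ⟨c, hc, h⟩ := key μ inferInstance inferInstance hμ
  obtain ⟨c', hc', h'⟩ := key μ' inferInstance inferInstance hμ'
  refine ⟨c / c', by positivity, fun f hf hfc => ?_⟩
  obtain ⟨F, hF, hFc, rfl⟩ := exists_fiberIntegral_eq hH Measure.haar hf hfc
  rw [h F hF hFc, h' F hF hFc]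
  field_simp

/-! ### Reduction to compactly supported continuous functions. -/

section Density

/-- Translates of one compact neighbourhood of `1` by a countable dense set cover `G`. This is the
source of the normality of `G ⧸ H₁` assumed in `IsFibration.hasSpectralGap`. -/
theorem sigmaCompactSpace_quotient {G : Type*} [Group G] [TopologicalSpace G]
    [IsTopologicalGroup G] [LocallyCompactSpace G] [SeparableSpace G] (H : Subgroup G) :
    SigmaCompactSpace (G ⧸ H) := by
  obtain ⟨D, hD, hDd⟩ := exists_countable_dense G
  obtain ⟨C, hC, hC1⟩ := exists_compact_mem_nhds (1 : G)
  refine SigmaCompactSpace.of_countable ((fun d : G => ((↑) '' (d • C) : Set (G ⧸ H))) '' D)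
    (hD.image _) ?_ (eq_univ_of_forall fun z => ?_)
  · rintro _ ⟨d, -, rfl⟩
    exact (hC.smul d).image QuotientGroup.continuous_mk
  · obtain ⟨x, rfl⟩ := QuotientGroup.mk_surjective z
    have hU : (fun d : G => d⁻¹ * x) ⁻¹' C ∈ 𝓝 x := by
      have : Continuous fun d : G => d⁻¹ * x := by fun_prop
      exact this.continuousAt.preimage_mem_nhds (by simpa using hC1)
    obtain ⟨d, hd, hdD⟩ := mem_closure_iff_nhds.1 (hDd x) _ hU
    exact ⟨_, ⟨d, hdD, rfl⟩, x, ⟨d⁻¹ * x, hd, by simp⟩, rfl⟩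

/-- A Poincaré type inequality on a dense set of vectors, up to a functional vanishing on the
invariant subspace `W`, excludes almost invariant vectors in `W`. -/
theorem not_almostHasInvariantVectors_of_dense {G E : Type*} [Group G] [TopologicalSpace G]
    [NormedAddCommGroup E] [InnerProductSpace ℂ E] {π : G →* (E ≃ₗᵢ[ℂ] E)} {W : Submodule ℂ E}
    (hW : ∀ g, ∀ ξ ∈ W, π g ξ ∈ W) {S : Set E} (hS : Dense S) (D : E →L[ℂ] ℂ)
    (hD : ∀ ξ ∈ W, D ξ = 0) {Q : Set G} (hQ : IsCompact Q) {R : ℝ} (hR : 0 < R)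
    (h : ∀ s ∈ S, ∀ B : ℝ, 0 ≤ B → (∀ g ∈ Q, ‖π g s - s‖ ^ 2 ≤ B) →
      ‖s‖ ^ 2 ≤ R * (B + ‖D s‖ ^ 2)) :
    ¬ AlmostHasInvariantVectors (restrictRep π W hW) := by
  intro hal
  -- An approximant `s` within `δ` of a unit vector `w` moves by at most `3 * δ`, and `‖D s‖ ≤ ‖D‖ *
  -- δ`, so the inequality gives `‖s‖ ^ 2 ≤ δ ^ 2 * b`. With `δ ≤ 1 / 4` and `δ * b < 1` this is
  -- below `1 / 4`, against `‖s‖ ≥ 3 / 4`.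
  let b : ℝ := R * (9 + ‖D‖ ^ 2)
  have hb : 0 < b := by positivity
  let δ : ℝ := 1 / (4 + b)
  have hδ : 0 < δ := by positivity
  have hδ4 : δ ≤ 1 / 4 := one_div_le_one_div_of_le (by norm_num) (by linarith)
  have hδb : δ * b < 1 := by
    rw [one_div_mul_eq_div, div_lt_one (by positivity)]; linarith
  obtain ⟨w, hw1, hw⟩ := hal Q hQ δ hδ
  obtain ⟨s, hs, hws⟩ := Metric.mem_closure_iff.1 (hS (w : E)) δ hδ
  rw [dist_eq_norm] at hws
  have hw1' : ‖(w : E)‖ = 1 := hw1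
  have hsn : 1 - δ ≤ ‖s‖ := by
    have := norm_sub_norm_le (w : E) s
    linarith
  have hDs : ‖D s‖ ≤ ‖D‖ * δ := by
    have e : D s = - D ((w : E) - s) := by rw [map_sub, hD _ w.2]; simp
    rw [e, norm_neg]
    exact (D.le_opNorm _).trans (by gcongr)
  have hmove : ∀ g ∈ Q, ‖π g s - s‖ ^ 2 ≤ (3 * δ) ^ 2 := fun g hg => by
    have h1 : ‖π g (w : E) - w‖ < δ := hw g hg
    have e : π g s - s = (π g (w : E) - w) - (π g ((w : E) - s) - ((w : E) - s)) := by
      rw [map_sub]; abel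
    have h2 : ‖π g ((w : E) - s)‖ = ‖(w : E) - s‖ := LinearIsometryEquiv.norm_map _ _
    have h3 := norm_sub_le (π g (w : E) - w) (π g ((w : E) - s) - ((w : E) - s))
    have h4 := norm_sub_le (π g ((w : E) - s)) ((w : E) - s)
    rw [e]
    gcongr
    linarith
  have hfin := h s hs _ (by positivity) hmove
  have h5 : ‖D s‖ ^ 2 ≤ (‖D‖ * δ) ^ 2 := by gcongr
  have h6 : (1 - δ) ^ 2 ≤ ‖s‖ ^ 2 := by
    have : 0 ≤ 1 - δ := by linarith
    gcongr
  have h7 : R * ((3 * δ) ^ 2 + ‖D s‖ ^ 2) ≤ δ * (δ * b) := by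
    calc R * ((3 * δ) ^ 2 + ‖D s‖ ^ 2) ≤ R * ((3 * δ) ^ 2 + (‖D‖ * δ) ^ 2) := by gcongr
      _ = δ * (δ * b) := by ring
  have h8 : δ * (δ * b) ≤ δ * 1 := by gcongr
  nlinarith

theorem dense_setOf_toLp {X : Type*} [TopologicalSpace X] [T2Space X] [LocallyCompactSpace X]
    [NormalSpace X] [MeasurableSpace X] [BorelSpace X] (m : Measure X) [m.Regular] :
    Dense {v : Lp ℂ 2 m | ∃ ξ : X → ℂ, Continuous ξ ∧ HasCompactSupport ξ ∧
      ∃ hξ : MemLp ξ 2 m, v = hξ.toLp ξ} := by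
  intro v
  rw [EMetric.mem_closure_iff]
  intro ε hε
  obtain ⟨δ, hδ, hδε⟩ := exists_between hε
  obtain ⟨ξ, hξs, hξ, hξc, hξm⟩ := (Lp.memLp v).exists_hasCompactSupport_eLpNorm_sub_le
    (by simp) hδ.ne'
  refine ⟨hξm.toLp ξ, ⟨ξ, hξc, hξs, hξm, rfl⟩, lt_of_le_of_lt ?_ hδε⟩
  rw [Lp.edist_def]
  refine le_trans (le_of_eq (eLpNorm_congr_ae ?_)) hξ
  filter_upwards [hξm.coeFn_toLp] with x hx
  simp [hx]

end Density

/-! ### Splitting off the mean on a finite measure space. -/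

section MeanZero

variable {Y : Type*} [MeasurableSpace Y] (ν : Measure Y) [IsFiniteMeasure ν]

/-- The constant function `1` in `L²`. -/
noncomputable def constOneLp : Lp ℂ 2 ν := (memLp_const (1 : ℂ)).toLp _

theorem inner_constOneLp (f : Lp ℂ 2 ν) : inner ℂ (constOneLp ν) f = ∫ y, f y ∂ν := by
  rw [L2.inner_def]
  apply integral_congr_ae
  filter_upwards [(memLp_const (1 : ℂ) : MemLp (fun _ : Y => (1 : ℂ)) 2 ν).coeFn_toLp] with y hy
  rw [constOneLp, hy]
  simp

theorem sq_norm_constOneLp : ‖constOneLp ν‖ ^ 2 = ν.real univ := by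
  rw [constOneLp, sq_norm_toLp]
  simp

theorem leftRegularRep_constOneLp {H : Type*} [Group H] [MulAction H Y]
    [MeasurableConstSMul H Y] [SMulInvariantMeasure H Y ν] (h : H) :
    leftRegularRep H ν h (constOneLp ν) = constOneLp ν := by
  apply Lp.ext
  have h1 := (memLp_const (1 : ℂ) : MemLp (fun _ : Y => (1 : ℂ)) 2 ν).coeFn_toLp
  filter_upwards [leftRegularRep_ae_eq H ν h (constOneLp ν), h1,
    (measurePreserving_smul h⁻¹ ν).quasiMeasurePreserving.ae h1] with y h2 h3 h4
  rw [h2]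
  exact h4.trans h3.symm

/-- The mean of a square integrable function. -/
noncomputable def meanLp (v : Lp ℂ 2 ν) : ℂ := inner ℂ (constOneLp ν) v / ν.real univ

/-- The projection of `L²` onto `L²₀`, for a finite measure. -/
noncomputable def meanZeroPart (v : Lp ℂ 2 ν) : L2zero ν :=
  ⟨v - meanLp ν v • constOneLp ν, fun _ => by
    rw [← inner_constOneLp, inner_sub_right, inner_smul_right, inner_self_eq_norm_sq_to_K,
      meanLp]
    have : ((‖constOneLp ν‖ : ℂ)) ^ 2 = ν.real univ := by
      rw [← Complex.ofReal_pow, sq_norm_constOneLp]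
    change _ - _ * (‖constOneLp ν‖ : ℂ) ^ 2 = 0
    rw [this]
    -- For the zero measure the mean is a division by zero, but then the constant function is itself
    -- `0` in `L²`.
    rcases eq_or_ne (ν.real univ) 0 with h | h
    · have h0 : constOneLp ν = 0 := by
        rw [← norm_eq_zero, ← sq_eq_zero_iff, sq_norm_constOneLp, h]
      simp [h0]
    · rw [div_mul_cancel₀ _ (by exact_mod_cast h), sub_self]⟩

theorem meanLp_sub (v w : Lp ℂ 2 ν) : meanLp ν (v - w) = meanLp ν v - meanLp ν w := by
  rw [meanLp, inner_sub_right, sub_div]; rfl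

theorem meanZeroPart_sub (v w : Lp ℂ 2 ν) :
    meanZeroPart ν (v - w) = meanZeroPart ν v - meanZeroPart ν w := by
  ext1
  simp only [meanZeroPart, meanLp_sub, AddSubgroupClass.coe_sub, sub_smul]
  abel

theorem meanZeroPart_zero : meanZeroPart ν 0 = 0 := by
  simpa using meanZeroPart_sub ν 0 0

theorem continuous_meanZeroPart : Continuous (meanZeroPart ν) := by
  unfold meanZeroPart meanLp
  refine Continuous.subtype_mk ?_ _
  fun_prop

/-- Constants are fixed by the unitary action, so the mean is invariant. This equivariance turns
induced vectors for `λ` into induced vectors for `λ⁰`. -/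
theorem meanZeroPart_leftRegularRep {H : Type*} [Group H] [MulAction H Y]
    [MeasurableConstSMul H Y] [SMulInvariantMeasure H Y ν] (h : H) (v : Lp ℂ 2 ν) :
    meanZeroPart ν (leftRegularRep H ν h v) = leftRegularRepZero H ν h (meanZeroPart ν v) := by
  have e : meanLp ν (leftRegularRep H ν h v) = meanLp ν v := by
    have := (leftRegularRep H ν h).inner_map_map (constOneLp ν) v
    rw [leftRegularRep_constOneLp] at this
    rw [meanLp, this]; rfl
  ext1
  change _ = leftRegularRep H ν h (v - meanLp ν v • constOneLp ν)
  rw [map_sub, map_smul, leftRegularRep_constOneLp]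
  simp only [meanZeroPart, e]

/-- Cauchy–Schwarz against the constant function. -/
theorem sq_norm_meanLp_mul_le (v : Lp ℂ 2 ν) : ‖meanLp ν v‖ ^ 2 * ν.real univ ≤ ‖v‖ ^ 2 := by
  rcases eq_or_ne (ν.real univ) 0 with h | h
  · rw [h, mul_zero]; positivity
  have hpos : 0 < ν.real univ := lt_of_le_of_ne measureReal_nonneg h.symm
  have h1 : ‖inner ℂ (constOneLp ν) v‖ ^ 2 ≤ ν.real univ * ‖v‖ ^ 2 := by
    rw [← sq_norm_constOneLp, ← mul_pow]
    gcongr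
    exact norm_inner_le_norm _ _
  rw [meanLp, norm_div, div_pow, Complex.norm_real, Real.norm_of_nonneg measureReal_nonneg,
    div_mul_eq_mul_div, div_le_iff₀ (by positivity)]
  calc _ ≤ ν.real univ * ‖v‖ ^ 2 * ν.real univ := by gcongr
    _ = _ := by ring

theorem sq_norm_le_meanZeroPart (v : Lp ℂ 2 ν) :
    ‖v‖ ^ 2 ≤ 2 * ‖meanZeroPart ν v‖ ^ 2 + 2 * ν.real univ * ‖meanLp ν v‖ ^ 2 := by
  have e : v = (meanZeroPart ν v : Lp ℂ 2 ν) + meanLp ν v • constOneLp ν := by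
    simp [meanZeroPart]
  have h1 : ‖v‖ ≤ ‖meanZeroPart ν v‖ + ‖meanLp ν v‖ * ‖constOneLp ν‖ := by
    conv_lhs => rw [e]
    rw [← norm_smul]
    exact norm_add_le (meanZeroPart ν v : Lp ℂ 2 ν) (meanLp ν v • constOneLp ν)
  rw [← sq_norm_constOneLp]
  nlinarith [norm_nonneg v, sq_nonneg (‖meanZeroPart ν v‖ - ‖meanLp ν v‖ * ‖constOneLp ν‖)]

theorem sq_norm_meanZeroPart_le (v : Lp ℂ 2 ν) : ‖meanZeroPart ν v‖ ^ 2 ≤ 4 * ‖v‖ ^ 2 := by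
  have h1 : ‖meanZeroPart ν v‖ ≤ ‖v‖ + ‖meanLp ν v‖ * ‖constOneLp ν‖ := by
    rw [← norm_smul]
    exact norm_sub_le v (meanLp ν v • constOneLp ν)
  have h2 := sq_norm_meanLp_mul_le ν v
  rw [← sq_norm_constOneLp] at h2
  nlinarith [norm_nonneg (meanZeroPart ν v), sq_nonneg (‖v‖ - ‖meanLp ν v‖ * ‖constOneLp ν‖)]

end MeanZero

/-! ### Functions on the total space as induced vectors. -/

/-- Intertwining maps preserve induced vectors. -/
theorem IsInducedVector.map {G E E' : Type*} [Group G] [TopologicalSpace G]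
    [NormedAddCommGroup E] [InnerProductSpace ℂ E] [NormedAddCommGroup E']
    [InnerProductSpace ℂ E'] {H : Subgroup G} {σ : H →* (E ≃ₗᵢ[ℂ] E)} {σ' : H →* (E' ≃ₗᵢ[ℂ] E')}
    {V : G → E} (hV : IsInducedVector σ V) {T : E → E'} (hT : Continuous T) (h0 : T 0 = 0)
    (hσ : ∀ h v, T (σ h v) = σ' h (T v)) : IsInducedVector σ' fun x => T (V x) where
  continuous := hT.comp hV.continuous
  map_mul_inv x h := by rw [hV.map_mul_inv, hσ]
  exists_compact := by
    obtain ⟨K, hK, h⟩ := hV.exists_compact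
    exact ⟨K, hK, fun x hx => by rw [h x hx, h0]⟩

theorem AlmostHasInvariantVectors.leftRegularRepZero_of_infinite {H Y : Type*} [Group H]
    [TopologicalSpace H] [MulAction H Y] [MeasurableSpace Y] [MeasurableConstSMul H Y]
    {ν : Measure Y} [SMulInvariantMeasure H Y ν] (hν : ν univ = ∞)
    (h : AlmostHasInvariantVectors (leftRegularRep H ν)) :
    AlmostHasInvariantVectors (leftRegularRepZero H ν) := fun Q hQ ε hε => by
  obtain ⟨ξ, hξ, h'⟩ := h Q hQ ε hε
  exact ⟨⟨ξ, fun hlt => absurd hν hlt.ne⟩, hξ, h'⟩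

namespace IsFibration

variable {G X Y : Type*} [Group G] [TopologicalSpace G] [IsTopologicalGroup G]
  [TopologicalSpace X] [TopologicalSpace Y] [T2Space Y] {H : Subgroup G} [MulAction G X]
  [ContinuousSMul G X] [MulAction H Y] {i : Y → X} {q : X → G ⧸ H} [MeasurableSpace Y]
  [BorelSpace Y] {ν : Measure Y} [IsFiniteMeasureOnCompacts ν]

theorem memLp_fiber (hi : IsFibration H i q) {ξ : X → ℂ} (hc : Continuous ξ)
    (hs : HasCompactSupport ξ) (x : G) : MemLp (fun y => ξ (x • i y)) 2 ν :=
  (hi.continuous_fiber hc x).memLp_of_hasCompactSupport (hi.hasCompactSupport_fiber hs x)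

/-- A compactly supported continuous function on `X`, as a family of square integrable functions
on the fibres. -/
noncomputable def fiberVector (hi : IsFibration H i q) (ν : Measure Y)
    [IsFiniteMeasureOnCompacts ν] {ξ : X → ℂ} (hc : Continuous ξ) (hs : HasCompactSupport ξ)
    (x : G) : Lp ℂ 2 ν :=
  (hi.memLp_fiber hc hs x).toLp _

theorem sq_norm_fiberVector (hi : IsFibration H i q) {ξ : X → ℂ} (hc : Continuous ξ)
    (hs : HasCompactSupport ξ) (x : G) :
    ‖hi.fiberVector ν hc hs x‖ ^ 2 = ∫ y, ‖ξ (x • i y)‖ ^ 2 ∂ν :=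
  sq_norm_toLp _

theorem fiberVector_translate_sub (hi : IsFibration H i q) {ξ : X → ℂ} (hc : Continuous ξ)
    (hs : HasCompactSupport ξ) (g x : G) (hc' : Continuous fun x => ξ (g⁻¹ • x) - ξ x)
    (hs' : HasCompactSupport fun x => ξ (g⁻¹ • x) - ξ x) :
    hi.fiberVector ν hc' hs' x =
      hi.fiberVector ν hc hs (g⁻¹ * x) - hi.fiberVector ν hc hs x := by
  rw [fiberVector, fiberVector, fiberVector, ← MemLp.toLp_sub]
  apply MemLp.toLp_congr
  refine Eventually.of_forall fun y => ?_
  simp [mul_smul]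

variable [LocallyCompactSpace G] [ContinuousConstSMul H Y] [SMulInvariantMeasure H Y ν]

theorem isInducedVector_fiberVector (hi : IsFibration H i q) {ξ : X → ℂ} (hc : Continuous ξ)
    (hs : HasCompactSupport ξ) :
    IsInducedVector (leftRegularRep H ν) (hi.fiberVector ν hc hs) where
  continuous := by
    refine continuous_iff_continuousAt.2 fun x₀ => ?_
    -- With `x₀` frozen, the squared `L²` distance is a fibre integral continuous in `x` and zero at
    -- `x₀`.
    have hcont : Continuous fun x : G => ∫ y, ‖ξ (x • i y) - ξ (x₀ • i y)‖ ^ 2 ∂ν := by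
      refine continuous_integral_of_locally_compact_support
        (F := fun x y => ‖ξ (x • i y) - ξ (x₀ • i y)‖ ^ 2) ?_ fun C hC => ?_
      · have h1 := hc.comp hi.continuous_smul_apply
        have h2 := (hi.continuous_fiber hc x₀).comp (continuous_snd (X := G))
        exact (h1.sub h2).norm.pow 2
      · obtain ⟨K, hK, h⟩ := hi.exists_isCompact_fiber hs (hC.insert x₀)
        refine ⟨K, hK, fun x hx y hy => ?_⟩
        rw [h x (mem_insert_of_mem _ hx) y hy, h x₀ (mem_insert _ _) y hy]
        simp
    have h0 : Tendsto (fun x : G => √(∫ y, ‖ξ (x • i y) - ξ (x₀ • i y)‖ ^ 2 ∂ν)) (𝓝 x₀)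
        (𝓝 0) := by
      have := hcont.sqrt.tendsto x₀
      simpa using this
    rw [ContinuousAt, tendsto_iff_norm_sub_tendsto_zero]
    refine h0.congr fun x => ?_
    rw [Real.sqrt_eq_iff_mul_self_eq (integral_nonneg fun y => by positivity) (norm_nonneg _),
      ← sq, fiberVector, fiberVector, ← MemLp.toLp_sub, sq_norm_toLp]
    rfl
  map_mul_inv x h := by
    apply Lp.ext
    have h1 := (hi.memLp_fiber (ν := ν) hc hs x).coeFn_toLp
    filter_upwards [(hi.memLp_fiber (ν := ν) hc hs (x * (h⁻¹ : H))).coeFn_toLp,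
      leftRegularRep_ae_eq H ν h (hi.fiberVector ν hc hs x),
      (measurePreserving_smul h⁻¹ ν).quasiMeasurePreserving.ae h1] with y h2 h3 h4
    rw [h3, fiberVector, h2, fiberVector, h4, hi.mul_smul_apply]
  exists_compact := ⟨q '' tsupport ξ, hs.isCompact.image hi.continuous_proj, fun x hx => by
    rw [← norm_eq_zero, ← sq_eq_zero_iff, sq_norm_fiberVector]
    simp [hi.apply_eq_zero hx]⟩

omit [LocallyCompactSpace G] [ContinuousConstSMul H Y] [SMulInvariantMeasure H Y ν] in
theorem inducedNormSq_fiberVector [MeasurableSpace (G ⧸ H)] (hi : IsFibration H i q)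
    (μ : Measure (G ⧸ H)) {ξ : X → ℂ} (hc : Continuous ξ) (hs : HasCompactSupport ξ) :
    inducedNormSq μ (hi.fiberVector ν hc hs) =
      ∫ z, fiberIntegral H i ν (fun x => ‖ξ x‖ ^ 2) z ∂μ := by
  simp only [inducedNormSq, hi.sq_norm_fiberVector]
  rfl

theorem integral_eq_mul_complex [T2Space (G ⧸ H)] [MeasurableSpace (G ⧸ H)]
    [BorelSpace (G ⧸ H)] {μ : Measure (G ⧸ H)} [IsFiniteMeasureOnCompacts μ]
    [MeasurableSpace X] [BorelSpace X] {m : Measure X} [IsFiniteMeasureOnCompacts m]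
    (hi : IsFibration H i q) {c : ℝ}
    (hm : ∀ f : X → ℝ, Continuous f → HasCompactSupport f →
      ∫ x, f x ∂m = c * ∫ z, fiberIntegral H i ν f z ∂μ)
    {ξ : X → ℂ} (hc : Continuous ξ) (hs : HasCompactSupport ξ) :
    ∫ x, ξ x ∂m = c * ∫ z, fiberIntegral H i ν ξ z ∂μ := by
  have key : ∀ T : ℂ →L[ℝ] ℝ, T (∫ x, ξ x ∂m) = c * T (∫ z, fiberIntegral H i ν ξ z ∂μ) := by
    intro T
    rw [← T.integral_comp_comm (hc.integrable_of_hasCompactSupport hs),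
      ← T.integral_comp_comm (hi.integrable_fiberIntegral hc hs),
      hm (fun x => T (ξ x)) (T.continuous.comp hc) (hs.comp_left T.map_zero)]
    congr 2 with z
    exact T.integral_comp_comm (hi.integrable_fiber hc hs _)
  apply Complex.ext
  · simpa using key Complex.reCLM
  · simpa using key Complex.imCLM

/-- A cutoff equal to `1` on a compact `K` has fibre integrals at most the mass of `ν`, so `m K ≤ c
* ν(Y) * μ(G ⧸ H)` for every `K`; inner regularity concludes. -/
theorem measure_univ_lt_top [T2Space (G ⧸ H)] [MeasurableSpace (G ⧸ H)]
    [BorelSpace (G ⧸ H)] {μ : Measure (G ⧸ H)} [IsFiniteMeasure μ] [IsFiniteMeasure ν]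
    [T2Space X] [LocallyCompactSpace X] [MeasurableSpace X] [BorelSpace X] {m : Measure X}
    [m.Regular] (hi : IsFibration H i q) {c : ℝ} (hc0 : 0 < c)
    (hm : ∀ f : X → ℝ, Continuous f → HasCompactSupport f →
      ∫ x, f x ∂m = c * ∫ z, fiberIntegral H i ν f z ∂μ) : m univ < ∞ := by
  by_contra htop
  obtain ⟨K, -, hK, hlt⟩ := isOpen_univ.exists_lt_isCompact (μ := m)
    (r := ENNReal.ofReal (c * (ν.real univ * μ.real univ))) (by
      rw [not_lt_top_iff.1 htop]; exact ENNReal.ofReal_lt_top)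
  obtain ⟨χ, hχ1, -, hχc, hχ⟩ := exists_continuous_one_zero_of_isCompact hK isClosed_empty
    (disjoint_empty K)
  have h1 : m.real K ≤ ∫ x, χ x ∂m := by
    have hχi : Integrable χ m := χ.continuous.integrable_of_hasCompactSupport hχc
    calc m.real K = ∫ x in K, (1 : ℝ) ∂m := by simp
      _ = ∫ x in K, χ x ∂m := setIntegral_congr_fun hK.measurableSet fun x hx => (hχ1 hx).symm
      _ ≤ ∫ x, χ x ∂m := setIntegral_le_integral hχi (Eventually.of_forall fun x => (hχ x).1)
  have h2 : ∀ z, fiberIntegral H i ν χ z ≤ ν.real univ := fun z => by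
    obtain ⟨x, rfl⟩ := QuotientGroup.mk_surjective z
    rw [hi.fiberIntegral_mk]
    calc ∫ y, χ (x • i y) ∂ν ≤ ∫ _, (1 : ℝ) ∂ν :=
          integral_mono (hi.integrable_fiber χ.continuous hχc x) (integrable_const _)
            fun y => (hχ _).2
      _ = ν.real univ := by simp
  have h3 : ∫ z, fiberIntegral H i ν χ z ∂μ ≤ ν.real univ * μ.real univ := by
    calc ∫ z, fiberIntegral H i ν χ z ∂μ ≤ ∫ _, ν.real univ ∂μ :=
          integral_mono (hi.integrable_fiberIntegral χ.continuous hχc) (integrable_const _) h2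
      _ = _ := by rw [integral_const, smul_eq_mul, mul_comm]
  rw [hm χ χ.continuous hχc] at h1
  have h4 : m.real K ≤ c * (ν.real univ * μ.real univ) := h1.trans (by gcongr)
  rw [ENNReal.ofReal_lt_iff_lt_toReal (by positivity) hK.measure_lt_top.ne] at hlt
  exact absurd hlt (not_lt.2 h4)

end IsFibration

/-! ### The spectral gap of the total space. -/

theorem inducedNormSq_le_mul {G E E' : Type*} [Group G] [TopologicalSpace G]
    [IsTopologicalGroup G] [NormedAddCommGroup E] [InnerProductSpace ℂ E]
    [NormedAddCommGroup E'] {H : Subgroup G} {σ : H →* (E ≃ₗᵢ[ℂ] E)} [T2Space (G ⧸ H)]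
    [MeasurableSpace (G ⧸ H)] [BorelSpace (G ⧸ H)] (μ : Measure (G ⧸ H))
    [IsFiniteMeasureOnCompacts μ] {V : G → E} (hV : IsInducedVector σ V) {W : G → E'} {C : ℝ}
    (h : ∀ x, ‖W x‖ ^ 2 ≤ C * ‖V x‖ ^ 2) : inducedNormSq μ W ≤ C * inducedNormSq μ V := by
  rw [inducedNormSq, inducedNormSq, ← integral_const_mul]
  refine integral_mono_of_nonneg (Eventually.of_forall fun z => ?_)
    (hV.integrable_norm_sq.const_mul C) (Eventually.of_forall fun z => h z.out)
  exact sq_nonneg ‖W z.out‖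

namespace IsFibration

variable {G X Y : Type*} [Group G] [TopologicalSpace G] [IsTopologicalGroup G]
  [LocallyCompactSpace G] [T2Space G]
  [TopologicalSpace X] [T2Space X] [LocallyCompactSpace X] [MeasurableSpace X] [BorelSpace X]
  [TopologicalSpace Y] [T2Space Y] [MeasurableSpace Y] [BorelSpace Y]
  {H : Subgroup G} [T2Space (G ⧸ H)] [MeasurableSpace (G ⧸ H)] [BorelSpace (G ⧸ H)]
  [MulAction G X] [ContinuousSMul G X] [MulAction H Y] [ContinuousConstSMul H Y]
  {i : Y → X} {q : X → G ⧸ H}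

omit [T2Space X] [LocallyCompactSpace X] [MeasurableSpace X] [BorelSpace X] in
/-- The Poincaré inequality on the total space when base and fibre have finite measure. -/
theorem exists_inducedNormSq_fiberVector_le_of_finite (hi : IsFibration H i q)
    (μ : Measure (G ⧸ H)) [μ.Regular] [IsFiniteMeasure μ] [SMulInvariantMeasure G (G ⧸ H) μ]
    (hμ : μ ≠ 0) (hgap : HasSpectralGap G μ)
    (ν : Measure Y) [IsFiniteMeasure ν] [SMulInvariantMeasure H Y ν]
    (hν : ν ≠ 0) (hgapν : HasSpectralGap H ν) :
    ∃ Q : Set G, IsCompact Q ∧ ∃ R : ℝ, 0 < R ∧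
      ∀ (ξ : X → ℂ) (hc : Continuous ξ) (hs : HasCompactSupport ξ) (B : ℝ), 0 ≤ B →
        (∀ g ∈ Q, inducedNormSq μ
          (fun x => hi.fiberVector ν hc hs (g⁻¹ * x) - hi.fiberVector ν hc hs x) ≤ B) →
        inducedNormSq μ (hi.fiberVector ν hc hs) ≤
          R * (B + ‖∫ z, fiberIntegral H i ν ξ z ∂μ‖ ^ 2) := by
  obtain ⟨Q₁, hQ₁, R₁, hR₁, h₁⟩ := exists_inducedNormSq_le_of_finite μ hμ hgap hgapν
  obtain ⟨Q₂, hQ₂, R₂, hR₂, h₂⟩ := hgap.exists_bound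
  have hM : 0 < μ.real univ :=
    ENNReal.toReal_pos (Measure.measure_univ_ne_zero.2 hμ) (measure_ne_top _ _)
  have hL : 0 < ν.real univ :=
    ENNReal.toReal_pos (Measure.measure_univ_ne_zero.2 hν) (measure_ne_top _ _)
  refine ⟨Q₁ ∪ Q₂, hQ₁.union hQ₂, (8 * R₁ + 4 * R₂) + 4 / (ν.real univ * μ.real univ),
    by positivity, fun ξ hc hs B hB hVB => ?_⟩
  let V : G → Lp ℂ 2 ν := hi.fiberVector ν hc hs
  have hV : IsInducedVector (leftRegularRep H ν) V := hi.isInducedVector_fiberVector hc hs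
  have hW : IsInducedVector (leftRegularRepZero H ν) fun x => meanZeroPart ν (V x) :=
    hV.map (continuous_meanZeroPart ν) (meanZeroPart_zero ν) (meanZeroPart_leftRegularRep ν)
  have hWbound : inducedNormSq μ (fun x => meanZeroPart ν (V x)) ≤ R₁ * (4 * B) := by
    refine h₁ _ hW (4 * B) (by positivity) fun g hg => ?_
    simp_rw [← meanZeroPart_sub]
    exact (inducedNormSq_le_mul μ ((hV.translate g).sub hV)
      fun x => sq_norm_meanZeroPart_le ν _).trans (by linarith [hVB g (Or.inl hg)])
  let f : G ⧸ H → ℂ := fiberIntegral H i ν ξ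
  have hfc : Continuous f := hi.continuous_fiberIntegral hc hs
  have hfs : HasCompactSupport f := hi.hasCompactSupport_fiberIntegral hs
  have hfi : Integrable f μ := hfc.integrable_of_hasCompactSupport hfs
  -- The means descend to the base as the scalar function `f`, to which the gap of the base applies
  -- once its own mean `κ` is subtracted.
  have hmean : ∀ x : G, f x = ν.real univ * meanLp ν (V x) := fun x => by
    rw [meanLp, mul_div_cancel₀ _ (by exact_mod_cast hL.ne'), inner_constOneLp]
    simp only [f]
    rw [hi.fiberIntegral_mk]
    exact (integral_congr_ae (hi.memLp_fiber hc hs x).coeFn_toLp).symm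
  have hf2 : Integrable (fun z => ‖f z‖ ^ 2) μ :=
    Continuous.integrable_of_hasCompactSupport (by fun_prop)
      (hfs.comp_left (g := fun t => ‖t‖ ^ 2) (by simp))
  have hfL : MemLp f 2 μ := hfc.memLp_of_hasCompactSupport hfs
  let κ : ℂ := (∫ z, f z ∂μ) / μ.real univ
  have hfκ : MemLp (fun z => f z - κ) 2 μ := hfL.sub (memLp_const κ)
  have hfκ2 : Integrable (fun z => ‖f z - κ‖ ^ 2) μ := hfκ.integrable_norm_pow (by norm_num)
  have hdev : ∫ z, ‖f z - κ‖ ^ 2 ∂μ ≤ R₂ * (ν.real univ * B) := by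
    refine h₂ _ hfκ (fun _ => ?_) _ (by positivity) fun g hg => ?_
    · rw [integral_sub hfi (integrable_const _), integral_const, Complex.real_smul,
        mul_div_cancel₀ _ (by exact_mod_cast hM.ne'), sub_self]
    · simp_rw [sub_sub_sub_cancel_right]
      refine le_trans ?_ (mul_le_mul_of_nonneg_left (hVB g (Or.inr hg)) hL.le)
      have hd := (hV.translate g).sub hV
      rw [inducedNormSq, ← integral_const_mul]
      refine integral_mono_of_nonneg (Eventually.of_forall fun z => by positivity)
        (hd.integrable_norm_sq.const_mul _) (Eventually.of_forall fun z => ?_)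
      obtain ⟨x, rfl⟩ := QuotientGroup.mk_surjective z
      dsimp only
      have e : f (g⁻¹ • (x : G ⧸ H)) = f ((g⁻¹ * x : G) : G ⧸ H) := rfl
      rw [onQuotient_mk hd.norm_sq_map_mul, e, hmean, hmean, ← mul_sub, ← meanLp_sub, norm_mul,
        mul_pow, Complex.norm_real, Real.norm_of_nonneg hL.le]
      have := sq_norm_meanLp_mul_le ν (V (g⁻¹ * x) - V x)
      calc _ = ν.real univ * (‖meanLp ν (V (g⁻¹ * x) - V x)‖ ^ 2 * ν.real univ) := by ring
        _ ≤ _ := by gcongr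
  -- No gap controls `κ`; it remains as the total integral of `ξ`.
  have hfbound : ∫ z, ‖f z‖ ^ 2 ∂μ ≤
      2 * (R₂ * (ν.real univ * B)) + 2 * (‖∫ z, f z ∂μ‖ ^ 2 / μ.real univ) := by
    calc ∫ z, ‖f z‖ ^ 2 ∂μ ≤ ∫ z, (2 * ‖f z - κ‖ ^ 2 + 2 * ‖κ‖ ^ 2) ∂μ := by
          refine integral_mono hf2 ((hfκ2.const_mul 2).add (integrable_const _)) fun z => ?_
          have h1 : ‖f z‖ ≤ ‖f z - κ‖ + ‖κ‖ := by
            simpa using norm_add_le (f z - κ) κ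
          dsimp only
          nlinarith [norm_nonneg (f z), sq_nonneg (‖f z - κ‖ - ‖κ‖)]
      _ = 2 * ∫ z, ‖f z - κ‖ ^ 2 ∂μ + 2 * (‖κ‖ ^ 2 * μ.real univ) := by
          rw [integral_add (hfκ2.const_mul 2) (integrable_const _), integral_const_mul,
            integral_const, smul_eq_mul]
          ring
      _ ≤ _ := by
          have : ‖κ‖ ^ 2 * μ.real univ = ‖∫ z, f z ∂μ‖ ^ 2 / μ.real univ := by
            rw [norm_div, Complex.norm_real, Real.norm_of_nonneg hM.le]
            field_simp
          rw [this]
          gcongr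
  calc inducedNormSq μ V ≤ ∫ z, (2 * onQuotient H (fun x => ‖meanZeroPart ν (V x)‖ ^ 2) z +
        2 / ν.real univ * ‖f z‖ ^ 2) ∂μ := by
        refine integral_mono hV.integrable_norm_sq
          ((hW.integrable_norm_sq.const_mul 2).add (hf2.const_mul _)) fun z => ?_
        obtain ⟨x, rfl⟩ := QuotientGroup.mk_surjective z
        dsimp only
        rw [onQuotient_mk hV.norm_sq_map_mul, onQuotient_mk hW.norm_sq_map_mul, hmean, norm_mul,
          mul_pow, Complex.norm_real, Real.norm_of_nonneg hL.le]
        refine (sq_norm_le_meanZeroPart ν (V x)).trans (le_of_eq ?_)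
        field_simp
    _ = 2 * inducedNormSq μ (fun x => meanZeroPart ν (V x)) +
          2 / ν.real univ * ∫ z, ‖f z‖ ^ 2 ∂μ := by
        rw [integral_add (hW.integrable_norm_sq.const_mul 2) (hf2.const_mul _),
          integral_const_mul, integral_const_mul, inducedNormSq]
    _ ≤ 2 * (R₁ * (4 * B)) + 2 / ν.real univ *
          (2 * (R₂ * (ν.real univ * B)) + 2 * (‖∫ z, f z ∂μ‖ ^ 2 / μ.real univ)) := by
        gcongr
    _ = (8 * R₁ + 4 * R₂) * B + 4 / (ν.real univ * μ.real univ) * ‖∫ z, f z ∂μ‖ ^ 2 := by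
        field_simp
        ring
    _ ≤ _ := by
        have h1 : 0 ≤ (8 * R₁ + 4 * R₂) * ‖∫ z, f z ∂μ‖ ^ 2 := by positivity
        have h2 : 0 ≤ 4 / (ν.real univ * μ.real univ) * B := by positivity
        change _ ≤ _ * (B + ‖∫ z, f z ∂μ‖ ^ 2)
        linarith

/-- If base and fibre have a spectral gap, so does the total space. -/
theorem hasSpectralGap [NormalSpace X] (hi : IsFibration H i q)
    (μ : Measure (G ⧸ H)) [μ.Regular] [SMulInvariantMeasure G (G ⧸ H) μ]
    (hμ : μ ≠ 0) (hgap : HasSpectralGap G μ)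
    (ν : Measure Y) [IsFiniteMeasureOnCompacts ν] [SMulInvariantMeasure H Y ν]
    (hν : ν ≠ 0) (hgapν : HasSpectralGap H ν)
    (m : Measure X) [m.Regular] [SMulInvariantMeasure G X m] {c : ℝ} (hc0 : 0 < c)
    (hm : ∀ f : X → ℝ, Continuous f → HasCompactSupport f →
      ∫ x, f x ∂m = c * ∫ z, fiberIntegral H i ν f z ∂μ) :
    HasSpectralGap G m := by
  -- `D` absorbs the one direction the gaps do not see: it is integration when base and fibre are
  -- both finite, and `0` otherwise.
  have core : ∃ D : Lp ℂ 2 m →L[ℂ] ℂ, (∀ f ∈ L2zero m, D f = 0) ∧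
      ∃ Q : Set G, IsCompact Q ∧ ∃ R : ℝ, 0 < R ∧
        ∀ (ξ : X → ℂ) (hc : Continuous ξ) (hs : HasCompactSupport ξ) (hξ : MemLp ξ 2 m) (B : ℝ),
          0 ≤ B → (∀ g ∈ Q, inducedNormSq μ
            (fun x => hi.fiberVector ν hc hs (g⁻¹ * x) - hi.fiberVector ν hc hs x) ≤ B) →
          inducedNormSq μ (hi.fiberVector ν hc hs) ≤ R * (B + ‖D (hξ.toLp ξ)‖ ^ 2) := by
    by_cases hμf : μ univ = ∞
    · obtain ⟨Q, hQ, R, hR, h⟩ :=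
        exists_inducedNormSq_le_of_infinite μ hgap hμf (leftRegularRep H ν)
      refine ⟨0, fun _ _ => rfl, Q, hQ, R, hR, fun ξ hc hs _ B hB hVB => ?_⟩
      simpa using h _ (hi.isInducedVector_fiberVector hc hs) B hB hVB
    have : IsFiniteMeasure μ := ⟨lt_top_iff_ne_top.2 hμf⟩
    by_cases hνf : ν univ = ∞
    · obtain ⟨Q, hQ, R, hR, h⟩ := exists_inducedNormSq_le_of_finite μ hμ hgap
        (σ := leftRegularRep H ν) fun h => hgapν (h.leftRegularRepZero_of_infinite hνf)
      refine ⟨0, fun _ _ => rfl, Q, hQ, R, hR, fun ξ hc hs _ B hB hVB => ?_⟩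
      simpa using h _ (hi.isInducedVector_fiberVector hc hs) B hB hVB
    have : IsFiniteMeasure ν := ⟨lt_top_iff_ne_top.2 hνf⟩
    have : IsFiniteMeasure m := ⟨hi.measure_univ_lt_top hc0 hm⟩
    obtain ⟨Q, hQ, R, hR, h⟩ :=
      hi.exists_inducedNormSq_fiberVector_le_of_finite μ hμ hgap ν hν hgapν
    refine ⟨innerSL ℂ (constOneLp m), fun f hf => ?_, Q, hQ, R * (1 + (c ^ 2)⁻¹), by positivity,
      fun ξ hc hs hξ B hB hVB => ?_⟩
    · rw [innerSL_apply_apply, inner_constOneLp]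
      exact hf (measure_lt_top _ _)
    · refine (h ξ hc hs B hB hVB).trans ?_
      rw [innerSL_apply_apply, inner_constOneLp, integral_congr_ae hξ.coeFn_toLp,
        hi.integral_eq_mul_complex hm hc hs, norm_mul, Complex.norm_real,
        Real.norm_of_nonneg hc0.le, mul_pow]
      set t := ‖∫ z, fiberIntegral H i ν ξ z ∂μ‖ ^ 2
      have ht : 0 ≤ t := by positivity
      rw [mul_assoc]
      gcongr
      have : (1 + (c ^ 2)⁻¹) * (B + c ^ 2 * t) = B + t + (c ^ 2)⁻¹ * B + c ^ 2 * t := by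
        field_simp; ring
      rw [this]
      have : 0 ≤ (c ^ 2)⁻¹ * B + c ^ 2 * t := by positivity
      linarith
  obtain ⟨D, hD, Q, hQ, R, hR, h⟩ := core
  have hnorm : ∀ (ξ : X → ℂ) (hc : Continuous ξ) (hs : HasCompactSupport ξ),
      ∫ x, ‖ξ x‖ ^ 2 ∂m = c * inducedNormSq μ (hi.fiberVector ν hc hs) := fun ξ hc hs => by
    rw [hi.inducedNormSq_fiberVector]
    exact hm _ (hc.norm.pow 2) (hs.comp_left (g := fun t => ‖t‖ ^ 2) (by simp))
  refine not_almostHasInvariantVectors_of_dense _ (dense_setOf_toLp m) D hD hQ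
    (R := R * (1 + c)) (by positivity) ?_
  rintro _ ⟨ξ, hc, hs, hξ, rfl⟩ B hB hVB
  -- Norms for `m` are `c` times those on the base, hence the rescaled bound.
  have hfin := h ξ hc hs hξ (B / c) (by positivity) fun g hg => by
    have hc' : Continuous fun x => ξ (g⁻¹ • x) - ξ x := (hc.comp (continuous_const_smul g⁻¹)).sub hc
    have hs' : HasCompactSupport fun x => ξ (g⁻¹ • x) - ξ x :=
      (hs.comp_homeomorph (Homeomorph.smul g⁻¹)).sub hs
    have e : leftRegularRep G m g (hξ.toLp ξ) - hξ.toLp ξ =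
        (hc'.memLp_of_hasCompactSupport hs').toLp _ := by
      apply Lp.ext
      filter_upwards [Lp.coeFn_sub (leftRegularRep G m g (hξ.toLp ξ)) (hξ.toLp ξ),
        leftRegularRep_ae_eq G m g (hξ.toLp ξ), hξ.coeFn_toLp,
        (hc'.memLp_of_hasCompactSupport hs' : MemLp _ 2 m).coeFn_toLp,
        (measurePreserving_smul g⁻¹ m).quasiMeasurePreserving.ae hξ.coeFn_toLp]
        with x h1 h2 h3 h4 h5
      rw [h1, Pi.sub_apply, h2, h3, h4, h5]
    have h1 := hVB g hg
    rw [e, sq_norm_toLp, hnorm _ hc' hs'] at h1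
    simp_rw [← hi.fiberVector_translate_sub hc hs g _ hc' hs']
    rw [le_div_iff₀ hc0, mul_comm]
    exact h1
  rw [sq_norm_toLp, hnorm ξ hc hs]
  set t := ‖D (hξ.toLp ξ)‖ ^ 2
  have ht : 0 ≤ t := by positivity
  calc c * inducedNormSq μ (hi.fiberVector ν hc hs) ≤ c * (R * (B / c + t)) := by gcongr
    _ = R * (B + c * t) := by field_simp
    _ ≤ R * ((1 + c) * (B + t)) := by
        gcongr
        nlinarith [mul_nonneg hc0.le hB]
    _ = _ := by ring

end IsFibration

/-- The measure on the total space of a fibration built from nonzero invariant measures on the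
base and on the fibre is nonzero. -/
theorem IsFibration.measure_ne_zero {G X Y : Type*} [Group G] [TopologicalSpace G]
    [IsTopologicalGroup G] [LocallyCompactSpace G] [TopologicalSpace X] [T2Space X]
    [LocallyCompactSpace X] [MeasurableSpace X] [TopologicalSpace Y] [T2Space Y] [Nonempty Y]
    [MeasurableSpace Y] [BorelSpace Y] {H : Subgroup G} [T2Space (G ⧸ H)]
    [MeasurableSpace (G ⧸ H)] [BorelSpace (G ⧸ H)] [MulAction G X] [ContinuousSMul G X]
    [MulAction H Y] [ContinuousConstSMul H Y] {i : Y → X} {q : X → G ⧸ H}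
    (hi : IsFibration H i q) (μ : Measure (G ⧸ H)) [IsFiniteMeasureOnCompacts μ]
    [μ.IsOpenPosMeasure] (ν : Measure Y) [IsFiniteMeasureOnCompacts ν]
    [SMulInvariantMeasure H Y ν] [ν.IsOpenPosMeasure] {m : Measure X}
    (hm : ∀ f : X → ℝ, Continuous f → HasCompactSupport f →
      ∫ x, f x ∂m = ∫ z, fiberIntegral H i ν f z ∂μ) : m ≠ 0 := by
  obtain ⟨y⟩ := ‹Nonempty Y›
  obtain ⟨f, hfc, hf0, hf1⟩ := exists_continuous_nonneg_pos (i y)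
  have hpos : 0 < fiberIntegral H i ν f ((1 : G) : G ⧸ H) := by
    rw [hi.fiberIntegral_mk]
    exact (hi.continuous_fiber f.continuous 1).integral_pos_of_hasCompactSupport_nonneg_nonzero
      (hi.hasCompactSupport_fiber hfc 1) (fun _ => hf0 _) (x := y) (by simpa using hf1)
  have := (hi.continuous_fiberIntegral (ν := ν) f.continuous
    hfc).integral_pos_of_hasCompactSupport_nonneg_nonzero (μ := μ)
    (hi.hasCompactSupport_fiberIntegral hfc) (fun _ => integral_nonneg fun _ => hf0 _) hpos.ne'
  rw [← hm f f.continuous hfc] at this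
  rintro rfl
  simp at this

/-! ### The fibration of `G ⧸ H₁` over `G ⧸ H₂`. -/

section Tower

variable {G : Type*} [Group G] (H₁ H₂ : Subgroup G)

/-- The inclusion of `H₂ ⧸ H₁` in `G ⧸ H₁`. -/
def quotientInclusion : H₂ ⧸ H₁.subgroupOf H₂ → G ⧸ H₁ :=
  Quotient.map' (fun h : H₂ => (h : G)) fun a b hab => by
    rw [QuotientGroup.leftRel_apply] at hab ⊢
    exact hab

theorem quotientInclusion_mk (h : H₂) : quotientInclusion H₁ H₂ h = ((h : G) : G ⧸ H₁) := rfl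

variable {H₁ H₂} in
/-- For closed subgroups `H₁ ≤ H₂`, the space `G ⧸ H₁` fibres over `G ⧸ H₂` with fibre
`H₂ ⧸ H₁`. -/
theorem isFibration_quotientInclusion [TopologicalSpace G] [IsTopologicalGroup G]
    (hH₂ : IsClosed (H₂ : Set G)) (hle : H₁ ≤ H₂) :
    IsFibration H₂ (quotientInclusion H₁ H₂) (Subgroup.quotientMapOfLE hle) where
  isClosedEmbedding := by
    refine IsClosedEmbedding.of_continuous_injective_isClosedMap ?_ ?_ ?_
    · rw [(QuotientGroup.isQuotientMap_mk _).continuous_iff]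
      exact QuotientGroup.continuous_mk.comp continuous_subtype_val
    · intro a b hab
      obtain ⟨a, rfl⟩ := QuotientGroup.mk_surjective a
      obtain ⟨b, rfl⟩ := QuotientGroup.mk_surjective b
      rw [quotientInclusion_mk, quotientInclusion_mk, QuotientGroup.eq] at hab
      exact QuotientGroup.eq.2 hab
    · intro A hA
      rw [← (QuotientGroup.isQuotientMap_mk H₁).isClosed_preimage]
      -- Since `H₁ ≤ H₂`, an `H₁`-coset meeting `H₂` lies in `H₂`; the preimage is therefore a
      -- closed subset of the closed subgroup `H₂`.
      have e : ((↑) : G → G ⧸ H₁) ⁻¹' (quotientInclusion H₁ H₂ '' A) =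
          ((↑) : H₂ → G) '' (((↑) : H₂ → H₂ ⧸ H₁.subgroupOf H₂) ⁻¹' A) := by
        ext x
        constructor
        · rintro ⟨a, ha, hax⟩
          obtain ⟨h, rfl⟩ := QuotientGroup.mk_surjective a
          rw [quotientInclusion_mk, QuotientGroup.eq] at hax
          have hx : x ∈ H₂ := by simpa using H₂.mul_mem h.2 (hle hax)
          refine ⟨⟨x, hx⟩, ?_, rfl⟩
          have : ((⟨x, hx⟩ : H₂) : H₂ ⧸ H₁.subgroupOf H₂) = h := 
            (QuotientGroup.eq (s := H₁.subgroupOf H₂) (a := h) (b := ⟨x, hx⟩)).2 hax |>.symm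
          rw [mem_preimage, this]
          exact ha
        · rintro ⟨h, hh, rfl⟩
          exact ⟨_, hh, rfl⟩
      rw [e]
      exact hH₂.isClosedEmbedding_subtypeVal.isClosedMap _
        (hA.preimage QuotientGroup.continuous_mk)
  map_smul h y := by
    obtain ⟨y, rfl⟩ := QuotientGroup.mk_surjective y
    rfl
  continuous_proj := by
    rw [(QuotientGroup.isQuotientMap_mk _).continuous_iff]
    exact QuotientGroup.continuous_mk
  proj_smul g x := by
    obtain ⟨x, rfl⟩ := QuotientGroup.mk_surjective x
    rfl
  proj_apply y := by
    obtain ⟨y, rfl⟩ := QuotientGroup.mk_surjective y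
    rw [quotientInclusion_mk]
    exact QuotientGroup.eq.2 (by simp)

end Tower

/-! ### The theorem for the tower of subgroups. -/

theorem proposition1 {G : Type*} [Group G] [TopologicalSpace G] [IsTopologicalGroup G]
    [T2Space G] [LocallyCompactSpace G] [SeparableSpace G]
    (H₁ H₂ : Subgroup G) (hH₁ : IsClosed (H₁ : Set G)) (hH₂ : IsClosed (H₂ : Set G))
    (hle : H₁ ≤ H₂)
    [MeasurableSpace (G ⧸ H₁)] [BorelSpace (G ⧸ H₁)]
    [MeasurableSpace (G ⧸ H₂)] [BorelSpace (G ⧸ H₂)]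
    [MeasurableSpace (H₂ ⧸ H₁.subgroupOf H₂)] [BorelSpace (H₂ ⧸ H₁.subgroupOf H₂)]
    (μ₂ : Measure (G ⧸ H₂)) [μ₂.Regular] [SMulInvariantMeasure G (G ⧸ H₂) μ₂] (hμ₂ : μ₂ ≠ 0)
    (ν : Measure (H₂ ⧸ H₁.subgroupOf H₂)) [ν.Regular]
    [SMulInvariantMeasure H₂ (H₂ ⧸ H₁.subgroupOf H₂) ν] (hν : ν ≠ 0)
    (hgapν : HasSpectralGap H₂ ν) (hgapμ₂ : HasSpectralGap G μ₂) :
    (∃ μ₁ : Measure (G ⧸ H₁), μ₁.Regular ∧ SMulInvariantMeasure G (G ⧸ H₁) μ₁ ∧ μ₁ ≠ 0) ∧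
    ∀ (μ₁ : Measure (G ⧸ H₁)) [μ₁.Regular] [SMulInvariantMeasure G (G ⧸ H₁) μ₁],
      μ₁ ≠ 0 → HasSpectralGap G μ₁ := by
  have : IsClosed (H₁ : Set G) := hH₁
  have : IsClosed (H₂ : Set G) := hH₂
  have : IsClosed (H₁.subgroupOf H₂ : Set H₂) := hH₁.preimage continuous_subtype_val
  have : LocallyCompactSpace H₂ := hH₂.isClosedEmbedding_subtypeVal.locallyCompactSpace
  have := sigmaCompactSpace_quotient H₁
  have hi := isFibration_quotientInclusion hH₂ hle
  have : μ₂.IsOpenPosMeasure := ⟨fun _ hU hne =>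
    (measure_isOpen_pos_of_smulInvariant_of_ne_zero G hμ₂ hU hne).ne'⟩
  have : ν.IsOpenPosMeasure := ⟨fun _ hU hne =>
    (measure_isOpen_pos_of_smulInvariant_of_ne_zero H₂ hν hU hne).ne'⟩
  obtain ⟨m, hm, hmi, hmf⟩ := hi.exists_measure (ν := ν) μ₂
  have hm0 : m ≠ 0 := hi.measure_ne_zero μ₂ ν hmf
  refine ⟨⟨m, hm, hmi, hm0⟩, fun μ₁ _ _ hμ₁ => ?_⟩
  obtain ⟨c, hc, h⟩ := exists_integral_eq_mul_of_smulInvariant hH₁ μ₁ m hμ₁ hm0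
  exact hi.hasSpectralGap μ₂ hμ₂ hgapμ₂ ν hν hgapν μ₁ hc fun f hf hfc => by
    rw [h f hf hfc, hmf f hf hfc]
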